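/- Let $k$ be a field and let $A$, $B$ be regular multiplier Hopf algebras over $k$ (associative algebras with local units and non-degenerate product, with comultiplications $\Delta_A:A\to M(A\otimes A)$ and $\Delta_B$). Let $R:B\otimes A\to A\otimes B$, $R(b\otimes a)=a_R\otimes b_R$, and $T:A\otimes B\to A\otimes B$, $T(a\otimes b)=a_T\otimes b_T$, be bijective linear maps (with $r$, $t$ denoting further copies of $R$, $T$) such that for all $a,c\in A$, $b,d\in B$ $$a_R\otimes (bd)_R=a_{Rr}\otimes b_rd_R,\quad (ac)_R\otimes b_R=a_Rc_r\otimes b_{Rr},\quad a_T\otimes (bd)_T=a_{Tt}\otimes b_Td_t,\quad (ac)_T\otimes b_T=a_Tc_t\otimes b_{tT},$$ $$a_T\otimes c_R\otimes d_{TR}=a_T\otimes c_R\otimes d_{RT},\qquad c_{TR}\otimes b_R\otimes d_T=c_{RT}\otimes b_R\otimes d_T .$$ Let $A\#_{RT}B$ be $A\otimes B$ with the (associative) product $(a\#b)(c\#d)=a_Tc_R\#b_Rd_T$. Put $(R*T)(p\otimes z)=p\cdot TR\tau(z)$ and $(T*R)(z\otimes p)=R\tau T(z)\cdot p$ for $p,z\in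 A\otimes B$, with the products taken in $A\#_{RT}B$ and $\tau:A\otimes B\to B\otimes A$ the flip. Assume that $(T*R)(z\otimes p)=0$ for all $p$ implies $z=0$, and that $(R*T)(p\otimes z)=0$ for all $p$ implies $z=0$. For $m\in M(A)$ and $n\in M(B)$, a multiplier $v\in M(A\#_{RT}B)$ is called $m\#n$ if for every $p\in A\#_{RT}B$ one has $vp=(me\#nf)p$ and $pv=p(em\#fn)$ for all sufficiently large $e\in A$, $f\in B$; that is, there are $e_0,f_0$ such that the first equality holds whenever $ee_0=e_0$, $ff_0=f_0$, and there are $e_0,f_0$ such that the second holds whenever $e_0e=e_0$, $f_0f=f_0$. For $z\in A\otimes B$, $\Delta_{RT}(z)$ is the multiplier of $(A\#_{RT}B)\otimes(A\#_{RT}B)$ with $$\Delta_{RT}(z)(q\otimes p)=T_1(z\otimes p)(q\otimes 1),\qquad (q\otimes p)\Delta_{RT}(z)=(1\otimes p)T_2(q\otimes z),$$ where $T_1,T_2$ are linear in $z=a\#x$ with $$T_1((a\#x)\otimes p)=\sum (a_1\#x_1)\otimes (a_2e\#x_2f)\,p,\qquad T_2(q\otimes(a\#x))=\sum q\,(ea_1\#fx_1)\otimes(a_2\#x_2)$$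 for all sufficiently large $e,f$ (in the same two senses respectively). For multipliers $M$ of $A\otimes A$ and $N$ of $B\otimes B$, $M\#(1\otimes 1)$ and $(1\otimes1)\#N$ denote the multipliers induced by the actions $(m\#1)T(b\otimes y)=T(mb\otimes y)$, $R(y\otimes b)(m\#1)=R(y\otimes bm)$ and $(1\#n)R(y\otimes b)=R(ny\otimes b)$, $T(b\otimes y)(1\#n)=T(b\otimes yn)$ in each pair of factors. Assume that for all $a\in A$, $x\in B$ the multiplier $\Delta_{RT}(R(x\otimes a))$ exists and $$\Delta_{RT}(R(x\otimes a))=\big((1\otimes 1)\#\Delta_B(x)\big)\big(\Delta_A(a)\#(1\otimes 1)\big).$$ Let $\varphi_A$, $\varphi_B$ be (non-zero) left integrals on $A$, $B$, with modular elements $\delta_A\in M(A)$, $\delta_B\in M(B)$, i.e. $(\varphi_A\otimes\mathrm{id})\Delta_A(a)=\varphi_A(a)\delta_A$ for all $a\in A$, and similarly for $B$. Then there is a unique linear map $\Delta_{RT}:A\#_{RT}B\to M((A\#_{RT}B)\otimes(A\#_{RT}B))$ as described; $\varphi_A\otimes\varphi_B$ is a left integral for it; the multiplier $\delta_A\#\delta_B\in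 M(A\#_{RT}B)$ exists and is unique; and it is the modular element associated to $\varphi_A\otimes\varphi_B$: it is the only $\delta$ with $((\varphi_A\otimes\varphi_B)\otimes \mathrm{id})\Delta_{RT}(z)=(\varphi_A\otimes\varphi_B)(z)\,\delta$ for all $z$. -/

import Mathlib

open scoped TensorProduct
open MulOpposite (op unop)

noncomputable section

namespace TwistedTensor

/-! ### Algebras without unit, multipliers

An algebra is a vector space `V` with a bilinear product `μ`; a (nonunital) ring `A` that is a
`k`-algebra is used through `LinearMap.mul k A`. -/

section Multipliers

variable {k V W : Type*} [Field k] [AddCommGroup V] [Module k V] [AddCommGroup W] [Module k W]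

/-- Pairs `m = (m₁, m₂)` of linear endomorphisms of `V`, with the componentwise product
`(m n)₁ = m₁ ∘ n₁`, `(m n)₂ = n₂ ∘ m₂`. We think of `m₁ v` as `m v` and of `m₂ v` as `v m`. -/
abbrev EndPair (k V : Type*) [Field k] [AddCommGroup V] [Module k V] : Type _ :=
  Module.End k V × (Module.End k V)ᵐᵒᵖ

/-- `m v`. -/
def EndPair.left (m : EndPair k V) : V →ₗ[k] V := m.1

/-- `v m`. -/
def EndPair.right (m : EndPair k V) : V →ₗ[k] V := unop m.2

/-- The pair with given components. -/
def EndPair.mk (l r : V →ₗ[k] V) : EndPair k V := (l, op r)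

/-- The algebra `M(V)` of multipliers of `(V, μ)`: pairs with `(a m) b = a (m b)`. -/
def multiplierAlgebra (μ : V →ₗ[k] V →ₗ[k] V) : Subalgebra k (EndPair k V) where
  carrier := {m | ∀ a b, μ (m.right a) b = μ a (m.left b)}
  mul_mem' := by
    intro m n hm hn a b
    have h1 := hn (m.right a) b
    have h2 := hm a (n.left b)
    exact h1.trans h2
  add_mem' := by
    intro m n hm hn a b
    have h1 : μ (m.right a) b = μ a (m.left b) := hm a b
    have h2 : μ (n.right a) b = μ a (n.left b) := hn a b
    change μ (m.right a + n.right a) b = μ a (m.left b + n.left b)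
    simp [h1, h2]
  algebraMap_mem' := by
    intro r a b
    change μ (r • a) b = μ a (r • b)
    simp

/-- The product is nondegenerate. -/
def IsNondegenerate (μ : V →ₗ[k] V →ₗ[k] V) : Prop :=
  (∀ a, (∀ b, μ a b = 0) → a = 0) ∧ (∀ b, (∀ a, μ a b = 0) → b = 0)

/-- The tensor product of two algebras: `(v ⊗ w) (v' ⊗ w') = v v' ⊗ w w'`. -/
def tensorMul (μ : V →ₗ[k] V →ₗ[k] V) (ν : W →ₗ[k] W →ₗ[k] W) :
    V ⊗[k] W →ₗ[k] V ⊗[k] W →ₗ[k] V ⊗[k] W :=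
  TensorProduct.map₂ μ ν

/-- An element `v` of the algebra, viewed as the multiplier `(v ·, · v)`. -/
def ofElem (μ : V →ₗ[k] V →ₗ[k] V) (v : V) : EndPair k V := EndPair.mk (μ v) (μ.flip v)

/-- `m ⊗ n`. -/
def tensorPair (m : EndPair k V) (n : EndPair k W) : EndPair k (V ⊗[k] W) :=
  EndPair.mk (TensorProduct.map m.left n.left) (TensorProduct.map m.right n.right)

/-- The image of a pair of endomorphisms of `V ⊗ V` under the flip `τ`. -/
def flipPair (m : EndPair k (V ⊗[k] V)) : EndPair k (V ⊗[k] V) :=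
  EndPair.mk
    ((TensorProduct.comm k V V).toLinearMap ∘ₗ m.left ∘ₗ (TensorProduct.comm k V V).toLinearMap)
    ((TensorProduct.comm k V V).toLinearMap ∘ₗ m.right ∘ₗ (TensorProduct.comm k V V).toLinearMap)

/-- `φ ⊗ id : V ⊗ V → V`. -/
def sliceLeft (φ : V →ₗ[k] k) : V ⊗[k] V →ₗ[k] V :=
  (TensorProduct.lid k V).toLinearMap ∘ₗ φ.rTensor V

/-- `id ⊗ φ : V ⊗ V → V`. -/
def sliceRight (φ : V →ₗ[k] k) : V ⊗[k] V →ₗ[k] V :=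
  (TensorProduct.rid k V).toLinearMap ∘ₗ φ.lTensor V

/-- `φ` is a left integral for `Δ : V → M(V ⊗ V)`: it is nonzero and `(id ⊗ φ) Δ(a) = φ(a) 1`, i.e.
`(b ⊗ 1) Δ(a)` lies in `V ⊗ V` and `(id ⊗ φ) ((b ⊗ 1) Δ(a)) = φ(a) b`. -/
def IsLeftIntegral (μ : V →ₗ[k] V →ₗ[k] V) (Δ : V → EndPair k (V ⊗[k] V)) (φ : V →ₗ[k] k) : Prop :=
  φ ≠ 0 ∧ ∀ a b, ∃ w : V ⊗[k] V,
    tensorPair (ofElem μ b) 1 * Δ a = ofElem (tensorMul μ μ) w ∧ sliceRight φ w = φ a • b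

/-- `δ` is the modular element associated to `φ`: `(φ ⊗ id) Δ(a) = φ(a) δ`, i.e. `Δ(a) (1 ⊗ b)` and
`(1 ⊗ b) Δ(a)` lie in `V ⊗ V`, and `φ ⊗ id` sends them to `φ(a) δ b` and to `φ(a) b δ`. -/
def IsModularElement (μ : V →ₗ[k] V →ₗ[k] V) (Δ : V → EndPair k (V ⊗[k] V)) (φ : V →ₗ[k] k)
    (δ : EndPair k V) : Prop :=
  ∀ a b,
    (∃ w : V ⊗[k] V, Δ a * tensorPair 1 (ofElem μ b) = ofElem (tensorMul μ μ) w ∧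
      sliceLeft φ w = φ a • δ.left b) ∧
    (∃ w : V ⊗[k] V, tensorPair 1 (ofElem μ b) * Δ a = ofElem (tensorMul μ μ) w ∧
      sliceLeft φ w = φ a • δ.right b)

end Multipliers

/-! ### Multiplier Hopf algebras -/

/-- Every finite subset has a left and a right unit. -/
def HasLocalUnits (A : Type*) [NonUnitalRing A] : Prop :=
  ∀ s : Finset A, ∃ e f : A, ∀ a ∈ s, e * a = a ∧ a * f = a

/-- A multiplier Hopf algebra structure on `A`. The maps `T₁`, `T₂` are determined by `comul`. -/
structure MultiplierHopf (k A : Type*) [Field k] [NonUnitalRing A] [Module k A]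
    [IsScalarTower k A A] [SMulCommClass k A A] where
  nondegenerate : IsNondegenerate (LinearMap.mul k A)
  /-- the comultiplication, a homomorphism `A → M(A ⊗ A)` -/
  comul : A →ₙₐ[k] multiplierAlgebra (tensorMul (LinearMap.mul k A) (LinearMap.mul k A))
  /-- `T₁ (a ⊗ b) = Δ(a) (1 ⊗ b)` -/
  T₁ : A ⊗[k] A ≃ₗ[k] A ⊗[k] A
  /-- `T₂ (a ⊗ b) = (a ⊗ 1) Δ(b)` -/
  T₂ : A ⊗[k] A ≃ₗ[k] A ⊗[k] A
  T₁_spec : ∀ a b, (comul a : EndPair k (A ⊗[k] A)) * tensorPair 1 (ofElem (LinearMap.mul k A) b) =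
    ofElem (tensorMul (LinearMap.mul k A) (LinearMap.mul k A)) (T₁ (a ⊗ₜ b))
  T₂_spec : ∀ a b, tensorPair (ofElem (LinearMap.mul k A) a) 1 * (comul b : EndPair k (A ⊗[k] A)) =
    ofElem (tensorMul (LinearMap.mul k A) (LinearMap.mul k A)) (T₂ (a ⊗ₜ b))
  /-- `(T₂ ⊗ id) (id ⊗ T₁) = (id ⊗ T₁) (T₂ ⊗ id)` -/
  coassoc :
    T₂.toLinearMap.rTensor A ∘ₗ (TensorProduct.assoc k A A A).symm.toLinearMap ∘ₗ
        T₁.toLinearMap.lTensor A ∘ₗ (TensorProduct.assoc k A A A).toLinearMap =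
      (TensorProduct.assoc k A A A).symm.toLinearMap ∘ₗ T₁.toLinearMap.lTensor A ∘ₗ
        (TensorProduct.assoc k A A A).toLinearMap ∘ₗ T₂.toLinearMap.rTensor A

/-- `A` is regular: the flipped comultiplication also makes `A` a multiplier Hopf algebra. -/
def MultiplierHopf.IsRegular {k A : Type*} [Field k] [NonUnitalRing A] [Module k A]
    [IsScalarTower k A A] [SMulCommClass k A A] (H : MultiplierHopf k A) : Prop :=
  ∃ H' : MultiplierHopf k A, ∀ a,
    (H'.comul a : EndPair k (A ⊗[k] A)) = flipPair (H.comul a : EndPair k (A ⊗[k] A))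

/-! ### The twisted tensor product `A #_{RT} B` -/

section Twisted

variable {k A B : Type*} [Field k]
  [NonUnitalRing A] [Module k A] [IsScalarTower k A A] [SMulCommClass k A A]
  [NonUnitalRing B] [Module k B] [IsScalarTower k B B] [SMulCommClass k B B]

/-- On `(A ⊗ B) ⊗ B`, the map `T` acting on the first and the third factor. -/
def T13AB (T : A ⊗[k] B ≃ₗ[k] A ⊗[k] B) : (A ⊗[k] B) ⊗[k] B →ₗ[k] (A ⊗[k] B) ⊗[k] B :=
  (TensorProduct.rightComm k A B B).toLinearMap ∘ₗ T.toLinearMap.rTensor B ∘ₗ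
    (TensorProduct.rightComm k A B B).toLinearMap

/-- On `A ⊗ (A ⊗ B)`, the map `T` acting on the first and the third factor. -/
def T13AA (T : A ⊗[k] B ≃ₗ[k] A ⊗[k] B) : A ⊗[k] (A ⊗[k] B) →ₗ[k] A ⊗[k] (A ⊗[k] B) :=
  (TensorProduct.leftComm k A A B).toLinearMap ∘ₗ T.toLinearMap.lTensor A ∘ₗ
    (TensorProduct.leftComm k A A B).toLinearMap

/-- The compatibility conditions on `R(b ⊗ a) = a_R ⊗ b_R` and `T(a ⊗ b) = a_T ⊗ b_T`. -/
structure IsTwistingPair (R : B ⊗[k] A ≃ₗ[k] A ⊗[k] B) (T : A ⊗[k] B ≃ₗ[k] A ⊗[k] B) : Prop where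
  /-- `R (m_B ⊗ id) = (id ⊗ m_B) R₁₂ R₂₃` on `B ⊗ B ⊗ A` -/
  R_mul_left : R.toLinearMap ∘ₗ (LinearMap.mul' k B).rTensor A =
    (LinearMap.mul' k B).lTensor A ∘ₗ (TensorProduct.assoc k A B B).toLinearMap ∘ₗ
      R.toLinearMap.rTensor B ∘ₗ (TensorProduct.assoc k B A B).symm.toLinearMap ∘ₗ
      R.toLinearMap.lTensor B ∘ₗ (TensorProduct.assoc k B B A).toLinearMap
  /-- `R (id ⊗ m_A) = (m_A ⊗ id) R₂₃ R₁₂` on `B ⊗ A ⊗ A` -/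
  R_mul_right : R.toLinearMap ∘ₗ (LinearMap.mul' k A).lTensor B ∘ₗ
      (TensorProduct.assoc k B A A).toLinearMap =
    (LinearMap.mul' k A).rTensor B ∘ₗ (TensorProduct.assoc k A A B).symm.toLinearMap ∘ₗ
      R.toLinearMap.lTensor A ∘ₗ (TensorProduct.assoc k A B A).toLinearMap ∘ₗ
      R.toLinearMap.rTensor A
  /-- `T (id ⊗ m_B) = (id ⊗ m_B) T₁₃ T₁₂` on `A ⊗ B ⊗ B` -/
  T_mul_right : T.toLinearMap ∘ₗ (LinearMap.mul' k B).lTensor A ∘ₗ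
      (TensorProduct.assoc k A B B).toLinearMap =
    (LinearMap.mul' k B).lTensor A ∘ₗ (TensorProduct.assoc k A B B).toLinearMap ∘ₗ
      T13AB T ∘ₗ T.toLinearMap.rTensor B
  /-- `T (m_A ⊗ id) = (m_A ⊗ id) T₁₃ T₂₃` on `A ⊗ A ⊗ B` -/
  T_mul_left : T.toLinearMap ∘ₗ (LinearMap.mul' k A).rTensor B ∘ₗ
      (TensorProduct.assoc k A A B).symm.toLinearMap =
    (LinearMap.mul' k A).rTensor B ∘ₗ (TensorProduct.assoc k A A B).symm.toLinearMap ∘ₗ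
      T13AA T ∘ₗ T.toLinearMap.lTensor A
  /-- `R₂₃ T₁₂ = T₁₃ R₂₃` on `A ⊗ B ⊗ A` -/
  comm_B : R.toLinearMap.lTensor A ∘ₗ (TensorProduct.assoc k A B A).toLinearMap ∘ₗ
      T.toLinearMap.rTensor A =
    T13AA T ∘ₗ R.toLinearMap.lTensor A ∘ₗ (TensorProduct.assoc k A B A).toLinearMap
  /-- `R₁₂ T₂₃ = T₁₃ R₁₂` on `B ⊗ A ⊗ B` -/
  comm_A : R.toLinearMap.rTensor B ∘ₗ (TensorProduct.assoc k B A B).symm.toLinearMap ∘ₗ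
      T.toLinearMap.lTensor B ∘ₗ (TensorProduct.assoc k B A B).toLinearMap =
    T13AB T ∘ₗ R.toLinearMap.rTensor B

/-- The product of `A #_{RT} B`, on the space `A ⊗ B`: `(a # b) (c # d) = a_T c_R # b_R d_T`. -/
def twistedMul (R : B ⊗[k] A ≃ₗ[k] A ⊗[k] B) (T : A ⊗[k] B ≃ₗ[k] A ⊗[k] B) :
    A ⊗[k] B →ₗ[k] A ⊗[k] B →ₗ[k] A ⊗[k] B :=
  TensorProduct.curry
    (TensorProduct.map (LinearMap.mul' k A)
        (LinearMap.mul' k B ∘ₗ (TensorProduct.comm k B B).toLinearMap) ∘ₗ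
      (TensorProduct.tensorTensorTensorComm k A B A B).toLinearMap ∘ₗ
      TensorProduct.map T.toLinearMap R.toLinearMap ∘ₗ
      (TensorProduct.tensorTensorTensorComm k A B B A).toLinearMap ∘ₗ
      (TensorProduct.comm k A B).toLinearMap.lTensor (A ⊗[k] B))

/-- `R * T : a ⊗ x ⊗ b ⊗ y ↦ (a b_R)_T ⊗ (x y_T)_R`. Expanding the outer `T` and `R` by the
compatibility conditions, this is the product of `a # x` with `T (R (y ⊗ b))`. -/
def RstarT (R : B ⊗[k] A ≃ₗ[k] A ⊗[k] B) (T : A ⊗[k] B ≃ₗ[k] A ⊗[k] B) :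
    (A ⊗[k] B) ⊗[k] (A ⊗[k] B) →ₗ[k] A ⊗[k] B :=
  TensorProduct.lift (twistedMul R T) ∘ₗ
    (T.toLinearMap ∘ₗ R.toLinearMap ∘ₗ (TensorProduct.comm k A B).toLinearMap).lTensor (A ⊗[k] B)

/-- `T * R : b ⊗ y ⊗ a ⊗ x ↦ (b_T a)_R ⊗ (y_R x)_T`. Expanding the outer `T` and `R` by the
compatibility conditions, this is the product of `R (τ (T (b ⊗ y)))` with `a # x`. -/
def TstarR (R : B ⊗[k] A ≃ₗ[k] A ⊗[k] B) (T : A ⊗[k] B ≃ₗ[k] A ⊗[k] B) :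
    (A ⊗[k] B) ⊗[k] (A ⊗[k] B) →ₗ[k] A ⊗[k] B :=
  TensorProduct.lift (twistedMul R T) ∘ₗ
    (R.toLinearMap ∘ₗ (TensorProduct.comm k A B).toLinearMap ∘ₗ T.toLinearMap).rTensor (A ⊗[k] B)

/-- `m # n = v` for multipliers `m` of `A` and `n` of `B`:
`(m # n) (b # y) = m_T b_r # n_r y_T` and `(b # y) (m # n) = b_T m_r # y_r n_T`,
where `m` and `n` are covered by local units, that is, `v p = (m e # n f) p` and
`p v = p (e m # f n)` for all sufficiently large `e ∈ A` and `f ∈ B`. -/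
def IsHash (R : B ⊗[k] A ≃ₗ[k] A ⊗[k] B) (T : A ⊗[k] B ≃ₗ[k] A ⊗[k] B)
    (m : EndPair k A) (n : EndPair k B) (v : EndPair k (A ⊗[k] B)) : Prop :=
  (∀ p, ∃ e₀ f₀, ∀ e f, e * e₀ = e₀ → f * f₀ = f₀ →
    v.left p = twistedMul R T (m.left e ⊗ₜ n.left f) p) ∧
  (∀ p, ∃ e₀ f₀, ∀ e f, e₀ * e = e₀ → f₀ * f = f₀ →
    v.right p = twistedMul R T p (m.right e ⊗ₜ n.right f))

/-- `M # (1 ⊗ 1)`, a pair of endomorphisms of `(A #_{RT} B) ⊗ (A #_{RT} B)`, for a multiplier `M` of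
`A ⊗ A`: with `m # 1` acting by `(m # 1) T(b ⊗ y) = T(m b ⊗ y)` and `R(y ⊗ b) (m # 1) = R(y ⊗ b m)`
in one pair of factors. -/
def hashOne (R : B ⊗[k] A ≃ₗ[k] A ⊗[k] B) (T : A ⊗[k] B ≃ₗ[k] A ⊗[k] B)
    (M : EndPair k (A ⊗[k] A)) : EndPair k ((A ⊗[k] B) ⊗[k] (A ⊗[k] B)) :=
  EndPair.mk
    (TensorProduct.map T.toLinearMap T.toLinearMap ∘ₗ
      (TensorProduct.tensorTensorTensorComm k A A B B).toLinearMap ∘ₗ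
      M.left.rTensor (B ⊗[k] B) ∘ₗ
      (TensorProduct.tensorTensorTensorComm k A B A B).toLinearMap ∘ₗ
      TensorProduct.map T.symm.toLinearMap T.symm.toLinearMap)
    (TensorProduct.map R.toLinearMap R.toLinearMap ∘ₗ
      (TensorProduct.tensorTensorTensorComm k B B A A).toLinearMap ∘ₗ
      M.right.lTensor (B ⊗[k] B) ∘ₗ
      (TensorProduct.tensorTensorTensorComm k B A B A).toLinearMap ∘ₗ
      TensorProduct.map R.symm.toLinearMap R.symm.toLinearMap)

/-- `(1 ⊗ 1) # N`, a pair of endomorphisms of `(A #_{RT} B) ⊗ (A #_{RT} B)`, for a multiplier `N` of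
`B ⊗ B`: with `1 # n` acting by `(1 # n) R(y ⊗ b) = R(n y ⊗ b)` and `T(b ⊗ y) (1 # n) = T(b ⊗ y n)`
in one pair of factors. -/
def oneHash (R : B ⊗[k] A ≃ₗ[k] A ⊗[k] B) (T : A ⊗[k] B ≃ₗ[k] A ⊗[k] B)
    (N : EndPair k (B ⊗[k] B)) : EndPair k ((A ⊗[k] B) ⊗[k] (A ⊗[k] B)) :=
  EndPair.mk
    (TensorProduct.map R.toLinearMap R.toLinearMap ∘ₗ
      (TensorProduct.tensorTensorTensorComm k B B A A).toLinearMap ∘ₗ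
      N.left.rTensor (A ⊗[k] A) ∘ₗ
      (TensorProduct.tensorTensorTensorComm k B A B A).toLinearMap ∘ₗ
      TensorProduct.map R.symm.toLinearMap R.symm.toLinearMap)
    (TensorProduct.map T.toLinearMap T.toLinearMap ∘ₗ
      (TensorProduct.tensorTensorTensorComm k A A B B).toLinearMap ∘ₗ
      N.right.lTensor (A ⊗[k] A) ∘ₗ
      (TensorProduct.tensorTensorTensorComm k A B A B).toLinearMap ∘ₗ
      TensorProduct.map T.symm.toLinearMap T.symm.toLinearMap)

/-- `a ⊗ x ↦ ∑ (a₁ ⊗ x₁) ⊗ (a₂ e ⊗ x₂ f)`. -/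
def coverRight (HA : MultiplierHopf k A) (HB : MultiplierHopf k B) (e : A) (f : B) :
    A ⊗[k] B →ₗ[k] (A ⊗[k] B) ⊗[k] (A ⊗[k] B) :=
  (TensorProduct.tensorTensorTensorComm k A A B B).toLinearMap ∘ₗ
    TensorProduct.map (HA.T₁.toLinearMap ∘ₗ (TensorProduct.mk k A A).flip e)
      (HB.T₁.toLinearMap ∘ₗ (TensorProduct.mk k B B).flip f)

/-- `a ⊗ x ↦ ∑ (e a₁ ⊗ f x₁) ⊗ (a₂ ⊗ x₂)`. -/
def coverLeft (HA : MultiplierHopf k A) (HB : MultiplierHopf k B) (e : A) (f : B) :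
    A ⊗[k] B →ₗ[k] (A ⊗[k] B) ⊗[k] (A ⊗[k] B) :=
  (TensorProduct.tensorTensorTensorComm k A A B B).toLinearMap ∘ₗ
    TensorProduct.map (HA.T₂.toLinearMap ∘ₗ TensorProduct.mk k A A e)
      (HB.T₂.toLinearMap ∘ₗ TensorProduct.mk k B B f)

/-- `w = T₁(z ⊗ p)` for `A #_{RT} B`, where
`T₁((a # x) ⊗ (b # y)) = ∑ (a₁ # x₁) ⊗ (a₂ # x₂) (b # y) = ∑ (a₁ # x₁) ⊗ (a₂_T b_r # x₂_r y_T)`,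
with `a₂` and `x₂` covered by all sufficiently large `e ∈ A` and `f ∈ B`. -/
def IsT1 (HA : MultiplierHopf k A) (HB : MultiplierHopf k B)
    (R : B ⊗[k] A ≃ₗ[k] A ⊗[k] B) (T : A ⊗[k] B ≃ₗ[k] A ⊗[k] B)
    (z p : A ⊗[k] B) (w : (A ⊗[k] B) ⊗[k] (A ⊗[k] B)) : Prop :=
  ∃ e₀ f₀, ∀ e f, e * e₀ = e₀ → f * f₀ = f₀ →
    w = ((twistedMul R T).flip p).lTensor (A ⊗[k] B) (coverRight HA HB e f z)

/-- `w = T₂(p ⊗ z)` for `A #_{RT} B`, where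
`T₂((b # y) ⊗ (a # x)) = ∑ (b # y) (a₁ # x₁) ⊗ (a₂ # x₂) = ∑ (b_T a₁_r # y_r x₁_T) ⊗ (a₂ # x₂)`,
with `a₁` and `x₁` covered by all sufficiently large `e ∈ A` and `f ∈ B`. -/
def IsT2 (HA : MultiplierHopf k A) (HB : MultiplierHopf k B)
    (R : B ⊗[k] A ≃ₗ[k] A ⊗[k] B) (T : A ⊗[k] B ≃ₗ[k] A ⊗[k] B)
    (p z : A ⊗[k] B) (w : (A ⊗[k] B) ⊗[k] (A ⊗[k] B)) : Prop :=
  ∃ e₀ f₀, ∀ e f, e₀ * e = e₀ → f₀ * f = f₀ →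
    w = (twistedMul R T p).rTensor (A ⊗[k] B) (coverLeft HA HB e f z)

/-- `Υ = Δ_{RT}(z)`: both `T₁(z ⊗ p)` and `T₂(q ⊗ z)` exist for all `p`, `q`, and
`Υ (q ⊗ p) = T₁(z ⊗ p) (q ⊗ 1)`, `(q ⊗ p) Υ = (1 ⊗ p) T₂(q ⊗ z)`. -/
def IsComulRT (HA : MultiplierHopf k A) (HB : MultiplierHopf k B)
    (R : B ⊗[k] A ≃ₗ[k] A ⊗[k] B) (T : A ⊗[k] B ≃ₗ[k] A ⊗[k] B)
    (z : A ⊗[k] B) (Υ : EndPair k ((A ⊗[k] B) ⊗[k] (A ⊗[k] B))) : Prop :=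
  (∀ p, ∃ w, IsT1 HA HB R T z p w ∧
    ∀ q, Υ.left (q ⊗ₜ p) = ((twistedMul R T).flip q).rTensor (A ⊗[k] B) w) ∧
  (∀ q, ∃ w, IsT2 HA HB R T q z w ∧
    ∀ p, Υ.right (q ⊗ₜ p) = (twistedMul R T p).lTensor (A ⊗[k] B) w)

/-- `φ_A ⊗ φ_B : A ⊗ B → k`. -/
def tensorFunctional (φA : A →ₗ[k] k) (φB : B →ₗ[k] k) : A ⊗[k] B →ₗ[k] k :=
  LinearMap.mul' k k ∘ₗ TensorProduct.map φA φB

end Twisted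

end TwistedTensor

end

namespace TwistedTensor

open Filter

/-! ### Limits of eventually constant nets of linear maps -/

section Limits

variable {k V W ι : Type*} [Field k] [AddCommGroup V] [Module k V] [AddCommGroup W] [Module k W]
  {l : Filter ι}

/-! Write `A # B` for the twisted product. "For all sufficiently large `e`, `f`" is convergence of
an eventually constant net along the filters `leftUnits` and `rightUnits`. Every covered expression
is such a limit, unique because the filters are proper.

Algebra. In `A # B` one has `T(a ⊗ x) = (a # 1)(1 # x)` and `R(x ⊗ a) = (1 # x)(a # 1)`, where `A`
and `B` act from either side through `T` or `R`. Every left action commutes with every right action: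
two of the four cases are visible in the coordinates given by `T` or `R`, the other two are the
compatibility conditions between `R` and `T`. This gives associativity, and the elements `T(e ⊗ f)`
are local units, whence nondegeneracy.

Comultiplication. Since `R` is surjective, every `z` is a sum of elements `R(x ⊗ a)`, for which the
multiplier is given; uniqueness of limits makes the assignment linear. By regularity the product
formula also shows that `(1 ⊗ p) Δ_{RT}(z)` lies in the tensor product.

Integral. Slicing `T₂(q ⊗ z)` at a large stage gives `φ(z) q (e # f)`, with `φ = φ_A ⊗ φ_B`. Hence
`q (e # f)` is eventually constant, and letting first `f` and then `e` grow identifies the constant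
as `q` (`IsTwistingPair.eq_of_eventually_mul`).

Modular element. Slicing `T₁(z ⊗ p)` gives `φ(z) (δ_A e # δ_B f) p`, which produces the left half of
`δ_A # δ_B`. The right half needs the limit of `q (e δ_A # f δ_B)`. Slicing the pentagon identity
shows that each modular element is group-like; it also acts injectively, so `δ` can be written as
`(id ⊗ ω) Δ(a₀)`, and slicing `T₂` by `ω_A ⊗ ω_B` yields the limit. Variants of `ω` giving `δ u`
with `u` a local unit show that the two halves form a multiplier (`exists_isHash_modular`). Its
modular identity holds on one side by slicing and on the other by cancelling a right factor. -/

theorem eventually_rTensor_eq {F : ι → V →ₗ[k] V} (hF : ∀ v, ∀ᶠ i in l, F i v = v)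
    (w : V ⊗[k] W) : ∀ᶠ i in l, (F i).rTensor W w = w := by
  induction w with
  | zero => simp
  | tmul v w => filter_upwards [hF v] with i hi using by simp [hi]
  | add x y hx hy => filter_upwards [hx, hy] with i h₁ h₂ using by simp [h₁, h₂]

theorem eventually_lTensor_eq {F : ι → V →ₗ[k] V} (hF : ∀ v, ∀ᶠ i in l, F i v = v)
    (w : W ⊗[k] V) : ∀ᶠ i in l, (F i).lTensor W w = w := by
  induction w with
  | zero => simp
  | tmul v w => filter_upwards [hF w] with i hi using by simp [hi]
  | add x y hx hy => filter_upwards [hx, hy] with i h₁ h₂ using by simp [h₁, h₂]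

/-- Finitely many eventual equalities hold at a common index, since the filter is proper; linearity
of the chosen limits is read off there. -/
theorem exists_linear_limit [l.NeBot] (F : ι → V →ₗ[k] W)
    (hF : ∀ v, ∃ w, ∀ᶠ i in l, w = F i v) : ∃ G : V →ₗ[k] W, ∀ v, ∀ᶠ i in l, G v = F i v := by
  choose g hg using hF
  refine ⟨{ toFun := g, map_add' := fun x y => ?_, map_smul' := fun c x => ?_ }, hg⟩
  · obtain ⟨i, h₁, h₂, h₃⟩ := ((hg (x + y)).and ((hg x).and (hg y))).exists
    rw [h₁, h₂, h₃, map_add]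
  · obtain ⟨i, h₁, h₂⟩ := ((hg (c • x)).and (hg x)).exists
    rw [h₁, h₂, map_smul, RingHom.id_apply]

end Limits

/-! ### Multipliers of an algebra with nondegenerate product -/

section Multipliers

variable {k V W : Type*} [Field k] [AddCommGroup V] [Module k V] [AddCommGroup W] [Module k W]
  {μ : V →ₗ[k] V →ₗ[k] V} {ν : W →ₗ[k] W →ₗ[k] W}

@[simp] theorem EndPair.left_mk (l r : V →ₗ[k] V) : (EndPair.mk l r).left = l := rfl
@[simp] theorem EndPair.right_mk (l r : V →ₗ[k] V) : (EndPair.mk l r).right = r := rfl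
@[simp] theorem EndPair.left_mul (m n : EndPair k V) : (m * n).left = m.left ∘ₗ n.left := rfl
@[simp] theorem EndPair.right_mul (m n : EndPair k V) : (m * n).right = n.right ∘ₗ m.right := rfl
@[simp] theorem EndPair.left_one : (1 : EndPair k V).left = LinearMap.id := rfl
@[simp] theorem EndPair.right_one : (1 : EndPair k V).right = LinearMap.id := rfl
@[simp] theorem EndPair.left_add (m n : EndPair k V) : (m + n).left = m.left + n.left := rfl
@[simp] theorem EndPair.right_add (m n : EndPair k V) : (m + n).right = m.right + n.right := rfl
@[simp] theorem EndPair.left_zero : (0 : EndPair k V).left = 0 := rfl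
@[simp] theorem EndPair.right_zero : (0 : EndPair k V).right = 0 := rfl
@[simp] theorem EndPair.left_smul (c : k) (m : EndPair k V) : (c • m).left = c • m.left := rfl
@[simp] theorem EndPair.right_smul (c : k) (m : EndPair k V) : (c • m).right = c • m.right := rfl
@[simp] theorem ofElem_left (v : V) : (ofElem μ v).left = μ v := rfl
@[simp] theorem ofElem_right (v : V) : (ofElem μ v).right = μ.flip v := rfl
@[simp] theorem tensorPair_left (m : EndPair k V) (n : EndPair k W) :
    (tensorPair m n).left = TensorProduct.map m.left n.left := rfl
@[simp] theorem tensorPair_right (m : EndPair k V) (n : EndPair k W) :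
    (tensorPair m n).right = TensorProduct.map m.right n.right := rfl
@[simp] theorem tensorMul_tmul (a b : V) (c d : W) :
    tensorMul μ ν (a ⊗ₜ c) (b ⊗ₜ d) = μ a b ⊗ₜ ν c d := rfl

theorem EndPair.ext {m n : EndPair k V} (hl : m.left = n.left) (hr : m.right = n.right) :
    m = n :=
  Prod.ext hl (MulOpposite.unop_injective hr)

theorem tensorMul_tmul_left (a : V) (c : W) (w : V ⊗[k] W) :
    tensorMul μ ν (a ⊗ₜ c) w = TensorProduct.map (μ a) (ν c) w := rfl

theorem tensorMul_tmul_right (a : V) (c : W) (w : V ⊗[k] W) :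
    tensorMul μ ν w (a ⊗ₜ c) = TensorProduct.map (μ.flip a) (ν.flip c) w := by
  induction w with
  | zero => simp
  | tmul v w => rfl
  | add x y hx hy => simp [hx, hy]

/-- The product is associative. -/
def IsAssociative (μ : V →ₗ[k] V →ₗ[k] V) : Prop :=
  ∀ a b c, μ (μ a b) c = μ a (μ b c)

theorem IsAssociative.tensorMul (hμ : IsAssociative μ) (hν : IsAssociative ν) :
    IsAssociative (tensorMul μ ν) := by
  intro a b c
  induction a with
  | zero => simp
  | add x y hx hy => simp only [map_add, LinearMap.add_apply, hx, hy]
  | tmul a₁ a₂ =>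
    induction b with
    | zero => simp
    | add x y hx hy => simp only [map_add, LinearMap.add_apply, hx, hy]
    | tmul b₁ b₂ =>
      induction c with
      | zero => simp
      | add x y hx hy => simp only [map_add, hx, hy]
      | tmul c₁ c₂ => simp only [tensorMul_tmul, hμ _ _ _, hν _ _ _]

theorem ofElem_mem (hμ : IsAssociative μ) (v : V) : ofElem μ v ∈ multiplierAlgebra μ :=
  fun a b => hμ a v b

theorem tensorPair_mem {m : EndPair k V} {n : EndPair k W} (hm : m ∈ multiplierAlgebra μ)
    (hn : n ∈ multiplierAlgebra ν) : tensorPair m n ∈ multiplierAlgebra (tensorMul μ ν) := by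
  intro a b
  induction a with
  | zero => simp
  | add x y hx hy => simp only [map_add, LinearMap.add_apply, hx, hy]
  | tmul a₁ a₂ =>
    induction b with
    | zero => simp
    | add x y hx hy => simp only [map_add, hx, hy]
    | tmul b₁ b₂ =>
      simp only [tensorPair_left, tensorPair_right, TensorProduct.map_tmul, tensorMul_tmul]
      rw [hm a₁ b₁, hn a₂ b₂]

/-- Every vector equals its product with some unit of the net, so it vanishes when all its products
do. The left and right units may be unrelated. -/
theorem isNondegenerate_of_units {ι κ : Type*} {l : Filter ι} {r : Filter κ} [l.NeBot] [r.NeBot]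
    {e : ι → V} {f : κ → V} (he : ∀ v, ∀ᶠ i in l, μ (e i) v = v)
    (hf : ∀ v, ∀ᶠ i in r, μ v (f i) = v) : IsNondegenerate μ := by
  refine ⟨fun a ha => ?_, fun b hb => ?_⟩
  · obtain ⟨i, hi⟩ := (hf a).exists
    rw [← hi, ha]
  · obtain ⟨i, hi⟩ := (he b).exists
    rw [← hi, hb]

theorem tensorMul_units_left {ι κ : Type*} {l : Filter ι} {r : Filter κ}
    {e : ι → V} {f : κ → W} (he : ∀ v, ∀ᶠ i in l, μ (e i) v = v)
    (hf : ∀ v, ∀ᶠ i in r, ν (f i) v = v) (w : V ⊗[k] W) :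
    ∀ᶠ i in l ×ˢ r, tensorMul μ ν (e i.1 ⊗ₜ f i.2) w = w := by
  filter_upwards [(eventually_rTensor_eq (F := fun i => μ (e i)) he w).prod_inl r,
    (eventually_lTensor_eq (F := fun i => ν (f i)) hf w).prod_inr l] with i h₁ h₂
  rw [tensorMul_tmul_left, ← LinearMap.rTensor_comp_lTensor, LinearMap.comp_apply, h₂, h₁]

theorem tensorMul_units_right {ι κ : Type*} {l : Filter ι} {r : Filter κ}
    {e : ι → V} {f : κ → W} (he : ∀ v, ∀ᶠ i in l, μ v (e i) = v)
    (hf : ∀ v, ∀ᶠ i in r, ν v (f i) = v) (w : V ⊗[k] W) :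
    ∀ᶠ i in l ×ˢ r, tensorMul μ ν w (e i.1 ⊗ₜ f i.2) = w := by
  filter_upwards [(eventually_rTensor_eq (F := fun i => μ.flip (e i)) he w).prod_inl r,
    (eventually_lTensor_eq (F := fun i => ν.flip (f i)) hf w).prod_inr l] with i h₁ h₂
  rw [tensorMul_tmul_right, ← LinearMap.rTensor_comp_lTensor, LinearMap.comp_apply, h₂, h₁]

namespace IsNondegenerate

theorem eq_of_mul_right (hμ : IsNondegenerate μ) {a b : V} (h : ∀ c, μ a c = μ b c) : a = b :=
  sub_eq_zero.mp <| hμ.1 _ fun c => by rw [map_sub, LinearMap.sub_apply, h, sub_self]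

theorem eq_of_mul_left (hμ : IsNondegenerate μ) {a b : V} (h : ∀ c, μ c a = μ c b) : a = b :=
  sub_eq_zero.mp <| hμ.2 _ fun c => by rw [map_sub, h, sub_self]

theorem ofElem_injective (hμ : IsNondegenerate μ) : Function.Injective (ofElem μ) :=
  fun a b h => hμ.eq_of_mul_right fun c => by rw [← ofElem_left, h, ofElem_left]

theorem ext_left (hμ : IsNondegenerate μ) {m n : EndPair k V} (hm : m ∈ multiplierAlgebra μ)
    (hn : n ∈ multiplierAlgebra μ) (h : m.left = n.left) : m = n :=
  EndPair.ext h <| LinearMap.ext fun a => hμ.eq_of_mul_right fun c => by rw [hm a c, hn a c, h]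

theorem ext_right (hμ : IsNondegenerate μ) {m n : EndPair k V} (hm : m ∈ multiplierAlgebra μ)
    (hn : n ∈ multiplierAlgebra μ) (h : m.right = n.right) : m = n :=
  EndPair.ext (LinearMap.ext fun a => hμ.eq_of_mul_left fun c => by rw [← hm c a, ← hn c a, h]) h

theorem left_mul_apply (hμ : IsNondegenerate μ) (hμ' : IsAssociative μ) {m : EndPair k V}
    (hm : m ∈ multiplierAlgebra μ) (a b : V) : m.left (μ a b) = μ (m.left a) b :=
  hμ.eq_of_mul_left fun c => by rw [← hm, ← hμ', ← hμ', hm]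

theorem right_mul_apply (hμ : IsNondegenerate μ) (hμ' : IsAssociative μ) {m : EndPair k V}
    (hm : m ∈ multiplierAlgebra μ) (a b : V) : m.right (μ a b) = μ a (m.right b) :=
  hμ.eq_of_mul_right fun c => by rw [hm, hμ', hμ', hm]

/-- With `ofElem_mul`, this says that the algebra is an ideal among its multipliers. Identities
between covered products are then checked as associativity in the multiplier algebra. -/
theorem mul_ofElem (hμ : IsNondegenerate μ) (hμ' : IsAssociative μ) {m : EndPair k V}
    (hm : m ∈ multiplierAlgebra μ) (v : V) : m * ofElem μ v = ofElem μ (m.left v) :=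
  EndPair.ext (LinearMap.ext fun a => hμ.left_mul_apply hμ' hm v a)
    (LinearMap.ext fun a => hm a v)

theorem ofElem_mul (hμ : IsNondegenerate μ) (hμ' : IsAssociative μ) {m : EndPair k V}
    (hm : m ∈ multiplierAlgebra μ) (v : V) : ofElem μ v * m = ofElem μ (m.right v) :=
  EndPair.ext (LinearMap.ext fun a => (hm v a).symm)
    (LinearMap.ext fun a => hμ.right_mul_apply hμ' hm a v)

end IsNondegenerate

end Multipliers

/-! ### Large elements of an algebra with local units -/

section Units

variable (A : Type*) [NonUnitalRing A]

/-- The filter of large elements in the sense `e e₀ = e₀`. -/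
def leftUnits : Filter A := ⨅ e₀ : A, 𝓟 {e | e * e₀ = e₀}

/-- The filter of large elements in the sense `e₀ e = e₀`. -/
def rightUnits : Filter A := ⨅ e₀ : A, 𝓟 {e | e₀ * e = e₀}

variable {A}

theorem eventually_leftUnits (a : A) : ∀ᶠ e in leftUnits A, e * a = a :=
  mem_iInf_of_mem a (mem_principal_self _)

theorem eventually_rightUnits (a : A) : ∀ᶠ e in rightUnits A, a * e = a :=
  mem_iInf_of_mem a (mem_principal_self _)

/-- Formally `1 - u = (1 - f)(1 - e)`, where `1 - e` kills the given elements from the left and `1 -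
f` from the right. -/
theorem HasLocalUnits.exists_unit (hA : HasLocalUnits A) (s : Finset A) :
    ∃ u : A, ∀ a ∈ s, u * a = a ∧ a * u = a := by
  obtain ⟨e, f, h⟩ := hA s
  refine ⟨e + f - f * e, fun a ha => ?_⟩
  obtain ⟨h₁, h₂⟩ := h a ha
  rw [sub_mul, add_mul, mul_assoc, h₁, mul_sub, mul_add, ← mul_assoc, h₂]
  constructor <;> abel

/-- Directedness: if `e` fixes a two-sided unit `u` of `a` and `b`, then it fixes `a = u a` and `b =
u b`. -/
theorem HasLocalUnits.leftUnits_hasBasis (hA : HasLocalUnits A) :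
    (leftUnits A).HasBasis (fun _ => True) fun e₀ => {e | e * e₀ = e₀} := by
  classical
  refine hasBasis_iInf_principal fun a b => ?_
  obtain ⟨u, hu⟩ := hA.exists_unit {a, b}
  refine ⟨u, fun e (he : e * u = u) => ?_, fun e (he : e * u = u) => ?_⟩
  · change e * a = a
    rw [← (hu a (by simp)).1, ← mul_assoc, he]
  · change e * b = b
    rw [← (hu b (by simp)).1, ← mul_assoc, he]

theorem HasLocalUnits.rightUnits_hasBasis (hA : HasLocalUnits A) :
    (rightUnits A).HasBasis (fun _ => True) fun e₀ => {e | e₀ * e = e₀} := by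
  classical
  refine hasBasis_iInf_principal fun a b => ?_
  obtain ⟨u, hu⟩ := hA.exists_unit {a, b}
  refine ⟨u, fun e (he : u * e = u) => ?_, fun e (he : u * e = u) => ?_⟩
  · change a * e = a
    rw [← (hu a (by simp)).2, mul_assoc, he]
  · change b * e = b
    rw [← (hu b (by simp)).2, mul_assoc, he]

/-- Some elements are large on both sides at once; compatibility of the two halves of `δ_A # δ_B`
needs them. -/
theorem HasLocalUnits.inf_neBot (hA : HasLocalUnits A) : (leftUnits A ⊓ rightUnits A).NeBot := by
  classical
  refine (hA.leftUnits_hasBasis.inf hA.rightUnits_hasBasis).neBot_iff.mpr fun {i} _ => ?_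
  obtain ⟨u, hu⟩ := hA.exists_unit {i.1, i.2}
  exact ⟨u, (hu i.1 (by simp)).1, (hu i.2 (by simp)).2⟩

theorem HasLocalUnits.leftUnits_neBot (hA : HasLocalUnits A) : (leftUnits A).NeBot :=
  hA.inf_neBot.mono inf_le_left

theorem HasLocalUnits.rightUnits_neBot (hA : HasLocalUnits A) : (rightUnits A).NeBot :=
  hA.inf_neBot.mono inf_le_right

variable {B : Type*} [NonUnitalRing B]

/-- Translates the quantifiers of `IsT1` and `IsHash` into filters. -/
theorem eventually_leftUnits_prod_iff (hA : HasLocalUnits A) (hB : HasLocalUnits B)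
    {P : A → B → Prop} : (∀ᶠ i in leftUnits A ×ˢ leftUnits B, P i.1 i.2) ↔
      ∃ e₀ f₀, ∀ e f, e * e₀ = e₀ → f * f₀ = f₀ → P e f := by
  rw [(hA.leftUnits_hasBasis.prod hB.leftUnits_hasBasis).eventually_iff]
  constructor
  · rintro ⟨⟨e₀, f₀⟩, -, h⟩
    exact ⟨e₀, f₀, fun e f he hf => h (x := (e, f)) ⟨he, hf⟩⟩
  · rintro ⟨e₀, f₀, h⟩
    exact ⟨⟨e₀, f₀⟩, ⟨trivial, trivial⟩, fun x hx => h x.1 x.2 hx.1 hx.2⟩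

theorem eventually_rightUnits_prod_iff (hA : HasLocalUnits A) (hB : HasLocalUnits B)
    {P : A → B → Prop} : (∀ᶠ i in rightUnits A ×ˢ rightUnits B, P i.1 i.2) ↔
      ∃ e₀ f₀, ∀ e f, e₀ * e = e₀ → f₀ * f = f₀ → P e f := by
  rw [(hA.rightUnits_hasBasis.prod hB.rightUnits_hasBasis).eventually_iff]
  constructor
  · rintro ⟨⟨e₀, f₀⟩, -, h⟩
    exact ⟨e₀, f₀, fun e f he hf => h (x := (e, f)) ⟨he, hf⟩⟩
  · rintro ⟨e₀, f₀, h⟩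
    exact ⟨⟨e₀, f₀⟩, ⟨trivial, trivial⟩, fun x hx => h x.1 x.2 hx.1 hx.2⟩

end Units

/-! ### Slices -/

section Slices

variable {k V W : Type*} [Field k] [AddCommGroup V] [Module k V] [AddCommGroup W] [Module k W]

@[simp] theorem sliceLeft_tmul (φ : V →ₗ[k] k) (a b : V) : sliceLeft φ (a ⊗ₜ b) = φ a • b := rfl
@[simp] theorem sliceRight_tmul (φ : V →ₗ[k] k) (a b : V) : sliceRight φ (a ⊗ₜ b) = φ b • a := rfl

theorem sliceLeft_lTensor (φ : V →ₗ[k] k) (f : V →ₗ[k] V) (w : V ⊗[k] V) :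
    sliceLeft φ (f.lTensor V w) = f (sliceLeft φ w) := by
  induction w with
  | zero => simp
  | tmul a b => simp
  | add x y hx hy => simp only [map_add, hx, hy]

theorem sliceRight_rTensor (φ : V →ₗ[k] k) (f : V →ₗ[k] V) (w : V ⊗[k] V) :
    sliceRight φ (f.rTensor V w) = f (sliceRight φ w) := by
  induction w with
  | zero => simp
  | tmul a b => simp
  | add x y hx hy => simp only [map_add, hx, hy]

theorem sliceRight_lTensor (φ : V →ₗ[k] k) (f : V →ₗ[k] V) (w : V ⊗[k] V) :
    sliceRight φ (f.lTensor V w) = sliceRight (φ ∘ₗ f) w := by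
  induction w with
  | zero => simp
  | tmul a b => simp
  | add x y hx hy => simp only [map_add, hx, hy]

theorem apply_sliceLeft (φ ψ : V →ₗ[k] k) (w : V ⊗[k] V) :
    ψ (sliceLeft φ w) = LinearMap.mul' k k (TensorProduct.map φ ψ w) := by
  induction w with
  | zero => simp
  | tmul a b => simp
  | add x y hx hy => simp only [map_add, hx, hy]

end Slices

/-! ### The pentagon equation and group-likeness of modular elements -/

section Pentagon

variable {k V : Type*} [Field k] [AddCommGroup V] [Module k V]

/-- `(Δ ⊗ id)(Δ(a) (1 ⊗ c)) (1 ⊗ b ⊗ 1)`, as a function of `b ⊗ c`, where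
`T₁ (a ⊗ b) = Δ(a) (1 ⊗ b)`. -/
def iteratedLeft (T₁ : V ⊗[k] V →ₗ[k] V ⊗[k] V) (a : V) : V ⊗[k] V →ₗ[k] V ⊗[k] (V ⊗[k] V) :=
  (TensorProduct.assoc k V V V).toLinearMap ∘ₗ
    (T₁ ∘ₗ (TensorProduct.comm k V V).toLinearMap).rTensor V ∘ₗ
    (TensorProduct.assoc k V V V).symm.toLinearMap ∘ₗ T₁.lTensor V ∘ₗ
    (TensorProduct.leftComm k V V V).toLinearMap ∘ₗ TensorProduct.mk k V (V ⊗[k] V) a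

theorem iteratedLeft_tmul (T₁ : V ⊗[k] V →ₗ[k] V ⊗[k] V) (a b c : V) :
    iteratedLeft T₁ a (b ⊗ₜ c) = TensorProduct.assoc k V V V
      ((T₁ ∘ₗ (TensorProduct.mk k V V).flip b).rTensor V (T₁ (a ⊗ₜ c))) := by
  simp only [iteratedLeft, LinearMap.comp_apply, LinearEquiv.coe_coe, TensorProduct.mk_apply,
    TensorProduct.leftComm_tmul, LinearMap.lTensor_tmul]
  congr 1
  induction T₁ (a ⊗ₜ c) with
  | zero => simp
  | tmul p q => simp
  | add x y hx hy => simp only [map_add, TensorProduct.tmul_add, hx, hy]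

variable {μ : V →ₗ[k] V →ₗ[k] V} {T₁ T₂ : V ⊗[k] V →ₗ[k] V ⊗[k] V}
  {Λ : V →ₗ[k] V ⊗[k] V →ₗ[k] V ⊗[k] V}

/-- In Sweedler notation both sides are `a₁ ⊗ a₂ b₁ ⊗ a₃ b₂ c`. Here `Λ q` stands for left
multiplication by `Δ(q)`, and `hμ` allows the first leg to be covered by `x`, which is the form in
which coassociativity is available. -/
theorem pentagon (hμ : ∀ w : V ⊗[k] (V ⊗[k] V), (∀ x, (μ x).rTensor (V ⊗[k] V) w = 0) → w = 0)
    (h₁₂ : ∀ x a b, (μ x).rTensor V (T₁ (a ⊗ₜ b)) = (μ.flip b).lTensor V (T₂ (x ⊗ₜ a)))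
    (hΛ : ∀ q b c, Λ q (b ⊗ₜ c) = (μ.flip b).rTensor V (T₁ (q ⊗ₜ c)))
    (hmul : ∀ q b c, T₁ (μ q b ⊗ₜ c) = Λ q (T₁ (b ⊗ₜ c)))
    (coassoc : ∀ x a b,
      T₂.rTensor V ((TensorProduct.assoc k V V V).symm (x ⊗ₜ T₁ (a ⊗ₜ b))) =
        (TensorProduct.assoc k V V V).symm
          (T₁.lTensor V (TensorProduct.assoc k V V V (T₂ (x ⊗ₜ a) ⊗ₜ b))))
    (a b c : V) :
    T₁.lTensor V (TensorProduct.assoc k V V V (T₁ (a ⊗ₜ b) ⊗ₜ c)) =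
      iteratedLeft T₁ a (T₁ (b ⊗ₜ c)) := by
  -- Both sides are `x a₁ ⊗ (a₂ ⊗ a₃) t`; coassociativity enters only here.
  have key : ∀ x t, (Λ.flip t).lTensor V (T₂ (x ⊗ₜ a)) =
      (μ x).rTensor (V ⊗[k] V) (iteratedLeft T₁ a t) := by
    intro x t
    induction t with
    | zero => simp
    | add s t hs ht => simp only [map_add, LinearMap.lTensor_add, LinearMap.add_apply, hs, ht]
    | tmul b' c' =>
      have e₁ : ∀ w : V ⊗[k] V, (Λ.flip (b' ⊗ₜ c')).lTensor V w =
          ((μ.flip b').rTensor V).lTensor V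
            (T₁.lTensor V (TensorProduct.assoc k V V V (w ⊗ₜ c'))) := by
        intro w
        induction w with
        | zero => simp
        | tmul p q => simp [hΛ]
        | add x y hx hy => simp only [map_add, TensorProduct.add_tmul, hx, hy]
      have e₂ : ∀ w : V ⊗[k] V, (μ x).rTensor (V ⊗[k] V) (TensorProduct.assoc k V V V
          ((T₁ ∘ₗ (TensorProduct.mk k V V).flip b').rTensor V w)) =
          ((μ.flip b').rTensor V).lTensor V (TensorProduct.assoc k V V V
            (T₂.rTensor V ((TensorProduct.assoc k V V V).symm (x ⊗ₜ w)))) := by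
        intro w
        induction w with
        | zero => simp
        | add x y hx hy => simp only [map_add, TensorProduct.tmul_add, hx, hy]
        | tmul p q =>
          have e₃ : ∀ w : V ⊗[k] V, (μ x).rTensor (V ⊗[k] V)
              (TensorProduct.assoc k V V V (w ⊗ₜ q)) =
              TensorProduct.assoc k V V V ((μ x).rTensor V w ⊗ₜ q) := by
            intro w
            induction w with
            | zero => simp
            | tmul p q => simp
            | add x y hx hy => simp only [map_add, TensorProduct.add_tmul, hx, hy]
          have e₄ : ∀ w : V ⊗[k] V, TensorProduct.assoc k V V V ((μ.flip b').lTensor V w ⊗ₜ q) =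
              ((μ.flip b').rTensor V).lTensor V (TensorProduct.assoc k V V V (w ⊗ₜ q)) := by
            intro w
            induction w with
            | zero => simp
            | tmul p q => simp
            | add x y hx hy => simp only [map_add, TensorProduct.add_tmul, hx, hy]
          simp only [LinearMap.rTensor_tmul, LinearMap.comp_apply, LinearMap.flip_apply,
            TensorProduct.mk_apply, TensorProduct.assoc_symm_tmul]
          rw [e₃, h₁₂, e₄]
      rw [e₁, iteratedLeft_tmul, e₂, coassoc, LinearEquiv.apply_symm_apply]
  refine sub_eq_zero.mp (hμ _ fun x => ?_)
  rw [map_sub, sub_eq_zero, ← key]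
  have e₁ : ∀ w : V ⊗[k] V, (μ x).rTensor (V ⊗[k] V)
      (T₁.lTensor V (TensorProduct.assoc k V V V (w ⊗ₜ c))) =
      T₁.lTensor V (TensorProduct.assoc k V V V ((μ x).rTensor V w ⊗ₜ c)) := by
    intro w
    induction w with
    | zero => simp
    | tmul p q => simp
    | add x y hx hy => simp only [map_add, TensorProduct.add_tmul, hx, hy]
  have e₂ : ∀ w : V ⊗[k] V,
      T₁.lTensor V (TensorProduct.assoc k V V V ((μ.flip b).lTensor V w ⊗ₜ c)) =
      (Λ.flip (T₁ (b ⊗ₜ c))).lTensor V w := by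
    intro w
    induction w with
    | zero => simp
    | tmul p q => simp [hmul]
    | add x y hx hy => simp only [map_add, TensorProduct.add_tmul, hx, hy]
  rw [e₁, h₁₂, e₂]

/-- With `D` and `E` left and right multiplication by `δ`, this is `Δ(δ b) = (δ ⊗ δ) Δ(b)` covered
by `x` in the first leg. -/
theorem mul_modular_eq (hμ : ∀ w : V ⊗[k] (V ⊗[k] V), (∀ x, (μ x).rTensor (V ⊗[k] V) w = 0) → w = 0)
    (hμ' : ∀ w : V ⊗[k] V, (∀ x, (μ.flip x).lTensor V w = 0) → w = 0)
    (h₁₂ : ∀ x a b, (μ x).rTensor V (T₁ (a ⊗ₜ b)) = (μ.flip b).lTensor V (T₂ (x ⊗ₜ a)))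
    (hΛ : ∀ q b c, Λ q (b ⊗ₜ c) = (μ.flip b).rTensor V (T₁ (q ⊗ₜ c)))
    (hmul : ∀ q b c, T₁ (μ q b ⊗ₜ c) = Λ q (T₁ (b ⊗ₜ c)))
    (coassoc : ∀ x a b,
      T₂.rTensor V ((TensorProduct.assoc k V V V).symm (x ⊗ₜ T₁ (a ⊗ₜ b))) =
        (TensorProduct.assoc k V V V).symm
          (T₁.lTensor V (TensorProduct.assoc k V V V (T₂ (x ⊗ₜ a) ⊗ₜ b))))
    {φ : V →ₗ[k] k} (hφ : φ ≠ 0) {D E : V →ₗ[k] V}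
    (hD : ∀ a b, μ a (D b) = μ (E a) b) (hD' : ∀ a b, D (μ a b) = μ (D a) b)
    (hφD : ∀ a b, sliceLeft φ (T₁ (a ⊗ₜ b)) = φ a • D b) (x b : V) :
    T₂ (x ⊗ₜ D b) = D.lTensor V (T₂ (E x ⊗ₜ b)) := by
  obtain ⟨a, ha⟩ : ∃ a, φ a ≠ 0 := by
    by_contra! h
    exact hφ (LinearMap.ext h)
  -- Applying `φ` to the first leg of the pentagon identity gives `φ(a) Δ(δ b)(1 ⊗ c)` on one side
  -- and `φ(a) (δ ⊗ δ) Δ(b)(1 ⊗ c)` on the other, and `φ(a) ≠ 0`.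
  have grouplike : ∀ c, T₁ (D b ⊗ₜ c) = TensorProduct.map D D (T₁ (b ⊗ₜ c)) := by
    intro c
    have h := congrArg (fun w => TensorProduct.lid k _ (φ.rTensor (V ⊗[k] V) w))
      (pentagon hμ h₁₂ hΛ hmul coassoc a b c)
    have e₁ : ∀ w : V ⊗[k] V, TensorProduct.lid k _ (φ.rTensor (V ⊗[k] V)
        (T₁.lTensor V (TensorProduct.assoc k V V V (w ⊗ₜ c)))) =
        T₁ (sliceLeft φ w ⊗ₜ c) := by
      intro w
      induction w with
      | zero => simp
      | tmul p q => simp [← TensorProduct.smul_tmul']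
      | add x y hx hy => simp only [map_add, TensorProduct.add_tmul, hx, hy]
    have e₂ : ∀ t : V ⊗[k] V, TensorProduct.lid k _ (φ.rTensor (V ⊗[k] V)
        (iteratedLeft T₁ a t)) = φ a • TensorProduct.map D D t := by
      intro t
      induction t with
      | zero => simp
      | add x y hx hy => simp only [map_add, smul_add, hx, hy]
      | tmul b' c' =>
        have e₃ : ∀ w : V ⊗[k] V, TensorProduct.lid k _ (φ.rTensor (V ⊗[k] V)
            (TensorProduct.assoc k V V V
              ((T₁ ∘ₗ (TensorProduct.mk k V V).flip b').rTensor V w))) =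
            D b' ⊗ₜ sliceLeft φ w := by
          intro w
          induction w with
          | zero => simp
          | add x y hx hy => simp only [map_add, TensorProduct.tmul_add, hx, hy]
          | tmul p q =>
            have e₄ : ∀ w : V ⊗[k] V, TensorProduct.lid k _ (φ.rTensor (V ⊗[k] V)
                (TensorProduct.assoc k V V V (w ⊗ₜ q))) = sliceLeft φ w ⊗ₜ q := by
              intro w
              induction w with
              | zero => simp
              | tmul p q => simp [TensorProduct.smul_tmul']
              | add x y hx hy => simp only [map_add, TensorProduct.add_tmul, hx, hy]
            simp only [LinearMap.rTensor_tmul, LinearMap.comp_apply, LinearMap.flip_apply,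
              TensorProduct.mk_apply, e₄, hφD, sliceLeft_tmul, TensorProduct.smul_tmul]
        rw [iteratedLeft_tmul, e₃, hφD, TensorProduct.map_tmul, TensorProduct.tmul_smul]
    simp only [e₁, e₂, hφD, ← TensorProduct.smul_tmul', map_smul] at h
    exact smul_right_injective _ ha h
  -- The cover `c` of the second leg is exchanged for the cover `x` of the first, which absorbs one
  -- factor `δ` as `x δ`.
  refine sub_eq_zero.mp (hμ' _ fun c => ?_)
  rw [map_sub, sub_eq_zero, ← h₁₂, grouplike]
  have e₁ : ∀ w : V ⊗[k] V, (μ.flip c).lTensor V (D.lTensor V w) =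
      D.lTensor V ((μ.flip c).lTensor V w) := by
    intro w
    induction w with
    | zero => simp
    | tmul p q => simp [hD']
    | add x y hx hy => simp only [map_add, hx, hy]
  have e₂ : ∀ w : V ⊗[k] V, (μ x).rTensor V (TensorProduct.map D D w) =
      D.lTensor V ((μ (E x)).rTensor V w) := by
    intro w
    induction w with
    | zero => simp
    | tmul p q => simp [hD]
    | add x y hx hy => simp only [map_add, hx, hy]
  rw [e₁, ← h₁₂, e₂]

end Pentagon

/-! ### Covering by elements of one tensor factor -/

section Elements

variable {k V W : Type*} [Field k] [AddCommGroup V] [Module k V] [AddCommGroup W] [Module k W]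
  {μ : V →ₗ[k] V →ₗ[k] V} {ν : W →ₗ[k] W →ₗ[k] W}

theorem tensorPair_ofElem_one_mul (hμ : IsAssociative μ) (hν : IsAssociative ν)
    (hn : IsNondegenerate (tensorMul μ ν)) (x : V) (w : V ⊗[k] W) :
    tensorPair (ofElem μ x) 1 * ofElem (tensorMul μ ν) w =
      ofElem (tensorMul μ ν) ((μ x).rTensor W w) :=
  hn.mul_ofElem (hμ.tensorMul hν) (tensorPair_mem (ofElem_mem hμ x) (one_mem _)) w

theorem tensorPair_one_ofElem_mul (hμ : IsAssociative μ) (hν : IsAssociative ν)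
    (hn : IsNondegenerate (tensorMul μ ν)) (x : W) (w : V ⊗[k] W) :
    tensorPair 1 (ofElem ν x) * ofElem (tensorMul μ ν) w =
      ofElem (tensorMul μ ν) ((ν x).lTensor V w) :=
  hn.mul_ofElem (hμ.tensorMul hν) (tensorPair_mem (one_mem _) (ofElem_mem hν x)) w

theorem mul_tensorPair_ofElem_one (hμ : IsAssociative μ) (hν : IsAssociative ν)
    (hn : IsNondegenerate (tensorMul μ ν)) (x : V) (w : V ⊗[k] W) :
    ofElem (tensorMul μ ν) w * tensorPair (ofElem μ x) 1 =
      ofElem (tensorMul μ ν) ((μ.flip x).rTensor W w) :=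
  hn.ofElem_mul (hμ.tensorMul hν) (tensorPair_mem (ofElem_mem hμ x) (one_mem _)) w

theorem mul_tensorPair_one_ofElem (hμ : IsAssociative μ) (hν : IsAssociative ν)
    (hn : IsNondegenerate (tensorMul μ ν)) (x : W) (w : V ⊗[k] W) :
    ofElem (tensorMul μ ν) w * tensorPair 1 (ofElem ν x) =
      ofElem (tensorMul μ ν) ((ν.flip x).lTensor V w) :=
  hn.ofElem_mul (hμ.tensorMul hν) (tensorPair_mem (one_mem _) (ofElem_mem hν x)) w

theorem tensorPair_one_ofElem_mul_ofElem_one (x : V) (y : W) :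
    tensorPair 1 (ofElem ν y) * tensorPair (ofElem μ x) 1 =
      ofElem (tensorMul μ ν) (x ⊗ₜ y) := by
  refine EndPair.ext ?_ ?_
  · exact TensorProduct.ext' fun a b => by simp
  · exact TensorProduct.ext' fun a b => by simp

theorem tensorPair_ofElem_one_mul_one_ofElem (x : V) (y : W) :
    tensorPair (ofElem μ x) 1 * tensorPair 1 (ofElem ν y) =
      ofElem (tensorMul μ ν) (x ⊗ₜ y) := by
  refine EndPair.ext ?_ ?_
  · exact TensorProduct.ext' fun a b => by simp
  · exact TensorProduct.ext' fun a b => by simp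

end Elements

/-! ### Group-likeness in terms of multipliers -/

section Modular

variable {k V : Type*} [Field k] [AddCommGroup V] [Module k V]

/-- Left multiplication by a multiplier, linear in the multiplier. -/
def EndPair.leftLinear : EndPair k V →ₗ[k] V →ₗ[k] V where
  toFun m := m.left
  map_add' _ _ := rfl
  map_smul' _ _ := rfl

/-- If `T₁ (a ⊗ b) = Δ(a) (1 ⊗ b)` and `(φ ⊗ id) Δ(a) = φ(a) δ`, then `Δ(δ b) = (δ ⊗ δ) Δ(b)`,
covered by an element in the first factor. -/
theorem T₂_modular_left {μ : V →ₗ[k] V →ₗ[k] V} (hμ : IsAssociative μ) {l r : Filter V} [l.NeBot]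
    [r.NeBot] (hl : ∀ v, ∀ᶠ e in l, μ e v = v) (hr : ∀ v, ∀ᶠ e in r, μ v e = v)
    {Δ : V →ₗ[k] EndPair k (V ⊗[k] V)} {T₁ T₂ : V ⊗[k] V →ₗ[k] V ⊗[k] V}
    (hΔ : ∀ a, Δ a ∈ multiplierAlgebra (tensorMul μ μ)) (hΔmul : ∀ a b, Δ (μ a b) = Δ a * Δ b)
    (hT₁ : ∀ a b, Δ a * tensorPair 1 (ofElem μ b) = ofElem (tensorMul μ μ) (T₁ (a ⊗ₜ b)))
    (hT₂ : ∀ a b, tensorPair (ofElem μ a) 1 * Δ b = ofElem (tensorMul μ μ) (T₂ (a ⊗ₜ b)))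
    (coassoc : ∀ x a b,
      T₂.rTensor V ((TensorProduct.assoc k V V V).symm (x ⊗ₜ T₁ (a ⊗ₜ b))) =
        (TensorProduct.assoc k V V V).symm
          (T₁.lTensor V (TensorProduct.assoc k V V V (T₂ (x ⊗ₜ a) ⊗ₜ b))))
    {φ : V →ₗ[k] k} (hφ : φ ≠ 0) {δ : EndPair k V} (hδ : δ ∈ multiplierAlgebra μ)
    (hφδ : ∀ a b, sliceLeft φ (T₁ (a ⊗ₜ b)) = φ a • δ.left b) (x b : V) :
    T₂ (x ⊗ₜ δ.left b) = δ.left.lTensor V (T₂ (δ.right x ⊗ₜ b)) := by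
  have hn : IsNondegenerate (tensorMul μ μ) :=
    isNondegenerate_of_units (tensorMul_units_left hl hl) (tensorMul_units_right hr hr)
  have hn₁ : IsNondegenerate μ := isNondegenerate_of_units hl hr
  -- The first two side conditions are cancellation by local units; the other three are
  -- associativity or multiplicativity of `Δ`, read in the multiplier algebra.
  refine mul_modular_eq (μ := μ) (Λ := EndPair.leftLinear ∘ₗ Δ) ?_ ?_ ?_ ?_ ?_ coassoc hφ
    (fun a b => (hδ a b).symm) (hn₁.left_mul_apply hμ hδ) hφδ x b
  · intro w hw
    obtain ⟨e, he⟩ := (eventually_rTensor_eq (F := fun e => μ e) hl w).exists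
    rw [← he, hw]
  · intro w hw
    obtain ⟨e, he⟩ := (eventually_lTensor_eq (F := fun e => μ.flip e) hr w).exists
    rw [← he, hw]
  · intro x a b
    refine hn.ofElem_injective ?_
    rw [← tensorPair_ofElem_one_mul hμ hμ hn, ← hT₁, ← mul_tensorPair_one_ofElem hμ hμ hn, ← hT₂,
      mul_assoc]
  · intro q b c
    refine hn.ofElem_injective ?_
    rw [← mul_tensorPair_ofElem_one hμ hμ hn, ← hT₁, mul_assoc,
      tensorPair_one_ofElem_mul_ofElem_one, hn.mul_ofElem (hμ.tensorMul hμ) (hΔ q)]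
    rfl
  · intro q b c
    refine hn.ofElem_injective ?_
    rw [← hT₁, hΔmul, mul_assoc, hT₁, hn.mul_ofElem (hμ.tensorMul hμ) (hΔ q)]
    rfl

/-- The pair with the two components exchanged, a multiplier of the opposite algebra. -/
def EndPair.swap (m : EndPair k V) : EndPair k V := EndPair.mk m.right m.left

theorem swap_ofElem (μ : V →ₗ[k] V →ₗ[k] V) (v : V) :
    (ofElem μ v).swap = ofElem μ.flip v := rfl

theorem tensorMul_flip (μ : V →ₗ[k] V →ₗ[k] V) :
    tensorMul μ.flip μ.flip = (tensorMul μ μ).flip := by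
  ext a b c d
  rfl

end Modular

/-! ### The four covered comultiplications of a regular multiplier Hopf algebra -/

section Hopf

variable {k A : Type*} [Field k] [NonUnitalRing A] [Module k A] [IsScalarTower k A A]
  [SMulCommClass k A A]

theorem isAssociative_mul : IsAssociative (LinearMap.mul k A) := mul_assoc

theorem HasLocalUnits.isNondegenerate_tensorMul (hA : HasLocalUnits A) :
    IsNondegenerate (tensorMul (LinearMap.mul k A) (LinearMap.mul k A)) := by
  have := hA.leftUnits_neBot
  have := hA.rightUnits_neBot
  exact isNondegenerate_of_units
    (tensorMul_units_left (μ := LinearMap.mul k A) (ν := LinearMap.mul k A)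
      eventually_leftUnits eventually_leftUnits)
    (tensorMul_units_right (μ := LinearMap.mul k A) (ν := LinearMap.mul k A)
      eventually_rightUnits eventually_rightUnits)

variable (H : MultiplierHopf k A)

/-- The comultiplication as a linear map with values in the pairs of endomorphisms. -/
def MultiplierHopf.comulLinear : A →ₗ[k] EndPair k (A ⊗[k] A) where
  toFun a := H.comul a
  map_add' a b := by rw [map_add]; rfl
  map_smul' c a := by rw [map_smul]; rfl

/-- `a ⊗ b ↦ (1 ⊗ b) Δ(a)`, where `H'` has the flipped comultiplication of `A`. -/
def MultiplierHopf.T₃ (H' : MultiplierHopf k A) : A ⊗[k] A ≃ₗ[k] A ⊗[k] A :=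
  TensorProduct.comm k A A ≪≫ₗ H'.T₂ ≪≫ₗ TensorProduct.comm k A A

/-- `b ⊗ a ↦ Δ(a) (b ⊗ 1)`, where `H'` has the flipped comultiplication of `A`. -/
def MultiplierHopf.T₄ (H' : MultiplierHopf k A) : A ⊗[k] A ≃ₗ[k] A ⊗[k] A :=
  TensorProduct.comm k A A ≪≫ₗ H'.T₁ ≪≫ₗ TensorProduct.comm k A A

variable {H}

theorem flipPair_mul {V : Type*} [AddCommGroup V] [Module k V] (m n : EndPair k (V ⊗[k] V)) :
    flipPair (m * n) = flipPair m * flipPair n := by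
  refine EndPair.ext ?_ ?_ <;> ext <;> simp [flipPair]

theorem flipPair_flipPair {V : Type*} [AddCommGroup V] [Module k V] (m : EndPair k (V ⊗[k] V)) :
    flipPair (flipPair m) = m := by
  refine EndPair.ext ?_ ?_ <;> ext <;> simp [flipPair]

theorem flipPair_tensorPair {V : Type*} [AddCommGroup V] [Module k V] (m n : EndPair k V) :
    flipPair (tensorPair m n) = tensorPair n m := by
  refine EndPair.ext ?_ ?_ <;> ext <;> simp [flipPair]

theorem flipPair_ofElem {V : Type*} [AddCommGroup V] [Module k V] (μ : V →ₗ[k] V →ₗ[k] V)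
    (w : V ⊗[k] V) : flipPair (ofElem (tensorMul μ μ) w) =
      ofElem (tensorMul μ μ) (TensorProduct.comm k V V w) := by
  induction w with
  | zero => refine EndPair.ext ?_ ?_ <;> ext <;> simp [flipPair]
  | tmul a b => refine EndPair.ext ?_ ?_ <;> ext <;> simp [flipPair]
  | add x y hx hy =>
    have h : ∀ x y, ofElem (tensorMul μ μ) (x + y) =
        ofElem (tensorMul μ μ) x + ofElem (tensorMul μ μ) y := fun x y => by
      refine EndPair.ext ?_ ?_ <;> ext <;> simp
    rw [h, map_add, h, ← hx, ← hy]
    refine EndPair.ext ?_ ?_ <;> ext <;> simp [flipPair]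

theorem T₃_spec {H' : MultiplierHopf k A}
    (hH : ∀ a, (H'.comul a : EndPair k (A ⊗[k] A)) = flipPair (H.comul a : EndPair k (A ⊗[k] A)))
    (a b : A) : tensorPair 1 (ofElem (LinearMap.mul k A) b) * (H.comul a : EndPair k (A ⊗[k] A)) =
      ofElem (tensorMul (LinearMap.mul k A) (LinearMap.mul k A)) (H'.T₃ (a ⊗ₜ b)) := by
  have h := congrArg flipPair (H'.T₂_spec b a)
  rw [flipPair_mul, hH, flipPair_flipPair, flipPair_tensorPair, flipPair_ofElem] at h
  exact h

theorem T₄_spec {H' : MultiplierHopf k A}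
    (hH : ∀ a, (H'.comul a : EndPair k (A ⊗[k] A)) = flipPair (H.comul a : EndPair k (A ⊗[k] A)))
    (b a : A) : (H.comul a : EndPair k (A ⊗[k] A)) * tensorPair (ofElem (LinearMap.mul k A) b) 1 =
      ofElem (tensorMul (LinearMap.mul k A) (LinearMap.mul k A)) (H'.T₄ (b ⊗ₜ a)) := by
  have h := congrArg flipPair (H'.T₁_spec a b)
  rw [flipPair_mul, hH, flipPair_flipPair, flipPair_tensorPair, flipPair_ofElem] at h
  exact h

theorem MultiplierHopf.coassoc_apply (H : MultiplierHopf k A) (x a b : A) :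
    H.T₂.toLinearMap.rTensor A ((TensorProduct.assoc k A A A).symm (x ⊗ₜ H.T₁ (a ⊗ₜ b))) =
      (TensorProduct.assoc k A A A).symm
        (H.T₁.toLinearMap.lTensor A (TensorProduct.assoc k A A A (H.T₂ (x ⊗ₜ a) ⊗ₜ b))) :=
  LinearMap.congr_fun H.coassoc ((x ⊗ₜ a) ⊗ₜ b)

/-- Coassociativity of the flipped comultiplication, read with the three legs in reverse order. Over
the opposite algebra `T₃` and `T₄` play the roles of `T₁` and `T₂`, so this is the coassociativity
required there. -/
theorem T₃_T₄_coassoc (H' : MultiplierHopf k A) (x a b : A) :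
    H'.T₄.toLinearMap.rTensor A ((TensorProduct.assoc k A A A).symm (x ⊗ₜ H'.T₃ (a ⊗ₜ b))) =
      (TensorProduct.assoc k A A A).symm
        (H'.T₃.toLinearMap.lTensor A (TensorProduct.assoc k A A A (H'.T₄ (x ⊗ₜ a) ⊗ₜ b))) := by
  -- `F` reverses the order of the three legs.
  set F : (A ⊗[k] A) ⊗[k] A →ₗ[k] (A ⊗[k] A) ⊗[k] A :=
    (TensorProduct.assoc k A A A).symm.toLinearMap ∘ₗ
      (TensorProduct.comm k A A).toLinearMap.lTensor A ∘ₗ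
      (TensorProduct.comm k (A ⊗[k] A) A).toLinearMap with hF
  have e₀ : ∀ (w : A ⊗[k] A) (q : A), F (w ⊗ₜ q) =
      (TensorProduct.assoc k A A A).symm (q ⊗ₜ TensorProduct.comm k A A w) := fun w q => by
    simp [hF]
  have e₁ : ∀ w : A ⊗[k] A, (TensorProduct.assoc k A A A).symm
      (H'.T₃.toLinearMap.lTensor A (TensorProduct.assoc k A A A
        (TensorProduct.comm k A A w ⊗ₜ b))) =
      F (H'.T₂.toLinearMap.rTensor A ((TensorProduct.assoc k A A A).symm (b ⊗ₜ w))) := by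
    intro w
    induction w with
    | zero => simp
    | add x y hx hy => simp only [map_add, TensorProduct.tmul_add, TensorProduct.add_tmul, hx, hy]
    | tmul p q =>
      simp only [TensorProduct.comm_tmul, TensorProduct.assoc_tmul, TensorProduct.assoc_symm_tmul,
        LinearMap.lTensor_tmul, LinearMap.rTensor_tmul, e₀]
      rfl
  have e₂ : ∀ w : A ⊗[k] A, H'.T₄.toLinearMap.rTensor A ((TensorProduct.assoc k A A A).symm
      (x ⊗ₜ TensorProduct.comm k A A w)) =
      F ((TensorProduct.assoc k A A A).symm
        (H'.T₁.toLinearMap.lTensor A (TensorProduct.assoc k A A A (w ⊗ₜ x)))) := by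
    intro w
    induction w with
    | zero => simp
    | add x y hx hy => simp only [map_add, TensorProduct.tmul_add, TensorProduct.add_tmul, hx, hy]
    | tmul p q =>
      simp only [TensorProduct.comm_tmul, TensorProduct.assoc_tmul, TensorProduct.assoc_symm_tmul,
        LinearMap.lTensor_tmul, LinearMap.rTensor_tmul, LinearEquiv.coe_coe]
      have e₃ : ∀ w : A ⊗[k] A, F ((TensorProduct.assoc k A A A).symm (p ⊗ₜ w)) =
          TensorProduct.comm k A A w ⊗ₜ p := by
        intro w
        induction w with
        | zero => simp
        | tmul r s => simp [hF]
        | add x y hx hy =>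
          simp only [map_add, TensorProduct.tmul_add, TensorProduct.add_tmul, hx, hy]
      rw [e₃]
      rfl
  have h := congrArg F (H'.coassoc_apply b a x)
  rw [← e₁, ← e₂] at h
  exact h.symm

/-! ### Left integrals and modular elements -/

section Integral

variable {H' : MultiplierHopf k A} {φ : A →ₗ[k] k} {δ : EndPair k A}

theorem exists_apply_eq_one {V : Type*} [AddCommGroup V] [Module k V] {φ : V →ₗ[k] k}
    (hφ : φ ≠ 0) : ∃ a, φ a = 1 :=
  LinearMap.surjective hφ 1

theorem T₁_mul_eq_mul_T₂ (hA : HasLocalUnits A) (x a b : A) :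
    (LinearMap.mul k A x).rTensor A (H.T₁ (a ⊗ₜ b)) =
      ((LinearMap.mul k A).flip b).lTensor A (H.T₂ (x ⊗ₜ a)) := by
  have hn := hA.isNondegenerate_tensorMul (k := k)
  refine hn.ofElem_injective ?_
  rw [← tensorPair_ofElem_one_mul isAssociative_mul isAssociative_mul hn, ← H.T₁_spec,
    ← mul_tensorPair_one_ofElem isAssociative_mul isAssociative_mul hn, ← H.T₂_spec, mul_assoc]

theorem T₄_mul_eq_mul_T₂ (hA : HasLocalUnits A)
    (hH : ∀ a, (H'.comul a : EndPair k (A ⊗[k] A)) = flipPair (H.comul a : EndPair k (A ⊗[k] A)))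
    (y b x : A) : (LinearMap.mul k A y).rTensor A (H'.T₄ (x ⊗ₜ b)) =
      ((LinearMap.mul k A).flip x).rTensor A (H.T₂ (y ⊗ₜ b)) := by
  have hn := hA.isNondegenerate_tensorMul (k := k)
  refine hn.ofElem_injective ?_
  rw [← tensorPair_ofElem_one_mul isAssociative_mul isAssociative_mul hn, ← T₄_spec hH,
    ← mul_tensorPair_ofElem_one isAssociative_mul isAssociative_mul hn, ← H.T₂_spec, mul_assoc]

theorem T₁_mul_eq_T₄_mul (hA : HasLocalUnits A)
    (hH : ∀ a, (H'.comul a : EndPair k (A ⊗[k] A)) = flipPair (H.comul a : EndPair k (A ⊗[k] A)))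
    (a x y : A) : ((LinearMap.mul k A).flip x).rTensor A (H.T₁ (a ⊗ₜ y)) =
      ((LinearMap.mul k A).flip y).lTensor A (H'.T₄ (x ⊗ₜ a)) := by
  have hn := hA.isNondegenerate_tensorMul (k := k)
  refine hn.ofElem_injective ?_
  rw [← mul_tensorPair_ofElem_one isAssociative_mul isAssociative_mul hn, ← H.T₁_spec,
    ← mul_tensorPair_one_ofElem isAssociative_mul isAssociative_mul hn, ← T₄_spec hH, mul_assoc,
    mul_assoc, tensorPair_one_ofElem_mul_ofElem_one, tensorPair_ofElem_one_mul_one_ofElem]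

theorem sliceRight_T₂ (hA : HasLocalUnits A)
    (hφ : IsLeftIntegral (LinearMap.mul k A) (fun a => H.comul a) φ) (a b : A) :
    sliceRight φ (H.T₂ (b ⊗ₜ a)) = φ a • b := by
  obtain ⟨w, h, h'⟩ := hφ.2 a b
  rw [H.T₂_spec] at h
  rw [hA.isNondegenerate_tensorMul.ofElem_injective h, h']

/-- Left invariance is defined with a cover on the left of `Δ(a)`. Multiplying by `y` on the left
reduces the cover on the right to that case, and nondegeneracy removes `y`. -/
theorem sliceRight_T₄ (hA : HasLocalUnits A)
    (hH : ∀ a, (H'.comul a : EndPair k (A ⊗[k] A)) = flipPair (H.comul a : EndPair k (A ⊗[k] A)))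
    (hφ : IsLeftIntegral (LinearMap.mul k A) (fun a => H.comul a) φ) (a x : A) :
    sliceRight φ (H'.T₄ (x ⊗ₜ a)) = φ a • x := by
  refine H.nondegenerate.eq_of_mul_left fun y => ?_
  rw [← sliceRight_rTensor, T₄_mul_eq_mul_T₂ hA hH, sliceRight_rTensor, sliceRight_T₂ hA hφ]
  simp

theorem sliceLeft_T₁ (hA : HasLocalUnits A)
    (hδ : IsModularElement (LinearMap.mul k A) (fun a => H.comul a) φ δ) (a b : A) :
    sliceLeft φ (H.T₁ (a ⊗ₜ b)) = φ a • δ.left b := by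
  obtain ⟨w, h, h'⟩ := (hδ a b).1
  rw [H.T₁_spec] at h
  rw [hA.isNondegenerate_tensorMul.ofElem_injective h, h']

theorem sliceLeft_T₃ (hA : HasLocalUnits A)
    (hH : ∀ a, (H'.comul a : EndPair k (A ⊗[k] A)) = flipPair (H.comul a : EndPair k (A ⊗[k] A)))
    (hδ : IsModularElement (LinearMap.mul k A) (fun a => H.comul a) φ δ) (a b : A) :
    sliceLeft φ (H'.T₃ (a ⊗ₜ b)) = φ a • δ.right b := by
  obtain ⟨w, h, h'⟩ := (hδ a b).2
  rw [T₃_spec hH] at h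
  rw [hA.isNondegenerate_tensorMul.ofElem_injective h, h']

theorem T₂_modular (hA : HasLocalUnits A) (hφ : φ ≠ 0)
    (hδmem : δ ∈ multiplierAlgebra (LinearMap.mul k A))
    (hδ : IsModularElement (LinearMap.mul k A) (fun a => H.comul a) φ δ) (x b : A) :
    H.T₂ (x ⊗ₜ δ.left b) = δ.left.lTensor A (H.T₂ (δ.right x ⊗ₜ b)) := by
  have := hA.leftUnits_neBot
  have := hA.rightUnits_neBot
  refine T₂_modular_left (μ := LinearMap.mul k A) (Δ := H.comulLinear) (T₁ := H.T₁.toLinearMap)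
    (T₂ := H.T₂.toLinearMap) isAssociative_mul eventually_leftUnits eventually_rightUnits
    (fun a => (H.comul a).2) (fun a b => ?_) H.T₁_spec H.T₂_spec H.coassoc_apply hφ hδmem
    (sliceLeft_T₁ hA hδ) x b
  change ((H.comul (a * b) :) : EndPair k (A ⊗[k] A)) = _
  rw [map_mul]
  rfl

/-- In the form `Δ(b δ)(x ⊗ 1) = Δ(b)(δ x ⊗ δ)`: this is `T₂_modular_left` for the opposite algebra,
where left and right multiplications are exchanged. -/
theorem T₄_modular (hA : HasLocalUnits A)
    (hH : ∀ a, (H'.comul a : EndPair k (A ⊗[k] A)) = flipPair (H.comul a : EndPair k (A ⊗[k] A)))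
    (hφ : φ ≠ 0) (hδmem : δ ∈ multiplierAlgebra (LinearMap.mul k A))
    (hδ : IsModularElement (LinearMap.mul k A) (fun a => H.comul a) φ δ) (x b : A) :
    H'.T₄ (x ⊗ₜ δ.right b) = δ.right.lTensor A (H'.T₄ (δ.left x ⊗ₜ b)) := by
  have := hA.leftUnits_neBot
  have := hA.rightUnits_neBot
  refine T₂_modular_left (μ := (LinearMap.mul k A).flip) (l := rightUnits A) (r := leftUnits A)
    (Δ := { toFun := fun a => (H.comulLinear a).swap,
            map_add' := fun a b => by rw [map_add]; rfl,
            map_smul' := fun c a => by rw [map_smul]; rfl })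
    (T₁ := H'.T₃.toLinearMap) (T₂ := H'.T₄.toLinearMap) (δ := δ.swap)
    (fun a b c => (mul_assoc c b a).symm) eventually_rightUnits eventually_leftUnits
    (fun a => ?_) (fun a b => ?_) (fun a b => ?_) (fun a b => ?_) (T₃_T₄_coassoc H') hφ
    (fun a b => (hδmem b a).symm) (sliceLeft_T₃ hA hH hδ) x b
  · rw [tensorMul_flip]
    exact fun p q => ((H.comul a).2 q p).symm
  · change ((H.comul (b * a) :) : EndPair k (A ⊗[k] A)).swap = _
    rw [map_mul]
    rfl
  · rw [tensorMul_flip, ← swap_ofElem]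
    exact congrArg EndPair.swap (T₃_spec hH a b)
  · rw [tensorMul_flip, ← swap_ofElem]
    exact congrArg EndPair.swap (T₄_spec hH a b)

/-- If `δ x = 0` then `Δ(b δ)(x ⊗ 1) = 0` by group-likeness, and slicing with `φ` gives `φ(b δ) x =
0` for every `b`. Some `φ(b δ)` is nonzero, for otherwise `φ ⊗ φ` would vanish on the image of the
surjective map `T₃`. -/
theorem modular_left_injective (hA : HasLocalUnits A) (hreg : H.IsRegular)
    (hφ : IsLeftIntegral (LinearMap.mul k A) (fun a => H.comul a) φ)
    (hδmem : δ ∈ multiplierAlgebra (LinearMap.mul k A))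
    (hδ : IsModularElement (LinearMap.mul k A) (fun a => H.comul a) φ δ) :
    Function.Injective δ.left := by
  obtain ⟨H', hH⟩ := hreg
  obtain ⟨b, hb⟩ : ∃ b, φ (δ.right b) ≠ 0 := by
    by_contra! h
    obtain ⟨a₁, ha₁⟩ := exists_apply_eq_one hφ.1
    have h' : ∀ w, LinearMap.mul' k k (TensorProduct.map φ φ (H'.T₃ w)) = 0 := by
      intro w
      induction w with
      | zero => simp
      | tmul a b => rw [← apply_sliceLeft, sliceLeft_T₃ hA hH hδ, map_smul, h, smul_zero]
      | add x y hx hy => simp only [map_add, hx, hy, add_zero]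
    have h'' := h' (H'.T₃.symm (a₁ ⊗ₜ a₁))
    rw [LinearEquiv.apply_symm_apply] at h''
    simp [ha₁] at h''
  refine (injective_iff_map_eq_zero _).mpr fun x hx => ?_
  have h := T₄_modular hA hH hφ.1 hδmem hδ x b
  rw [hx, TensorProduct.zero_tmul, map_zero, map_zero] at h
  have h' := sliceRight_T₄ hA hH hφ (δ.right b) x
  rw [h, map_zero] at h'
  exact (smul_eq_zero.mp h'.symm).resolve_left hb

/-- There are `a₀` and functionals `ω`, `ω_y` such that `(id ⊗ ω) Δ(a₀) = δ` and
`(id ⊗ ω_y) Δ(a₀) = δ u_y`, where the `u_y` are local units of `A`. -/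
theorem exists_slices_eq_modular (hA : HasLocalUnits A) (hreg : H.IsRegular)
    (hφ : IsLeftIntegral (LinearMap.mul k A) (fun a => H.comul a) φ)
    (hδmem : δ ∈ multiplierAlgebra (LinearMap.mul k A))
    (hδ : IsModularElement (LinearMap.mul k A) (fun a => H.comul a) φ δ) :
    ∃ (a₀ : A) (ω : A →ₗ[k] k) (ω' : A → A →ₗ[k] k) (u : A → A),
      (∀ c, sliceRight ω (H.T₂ (c ⊗ₜ a₀)) = δ.right c) ∧
      (∀ y c, sliceRight (ω' y) (H.T₂ (c ⊗ₜ a₀)) = δ.right c * u y) ∧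
      (∀ x, ∀ᶠ y in rightUnits A, u y * x = x) ∧ ∀ x, ∀ᶠ y in rightUnits A, x * u y = x := by
  obtain ⟨H', hH⟩ := id hreg
  obtain ⟨a, ha⟩ := exists_apply_eq_one hφ.1
  -- A merely linear left inverse of multiplication by `δ`: composing functionals with `g` cancels
  -- the `δ` in the second leg of `Δ(δ a) = (δ ⊗ δ) Δ(a)`.
  obtain ⟨g, hg⟩ := LinearMap.exists_leftInverse_of_injective δ.left
    (LinearMap.ker_eq_bot.mpr (modular_left_injective hA hreg hφ hδmem hδ))
  -- The local units are `u_y = (id ⊗ φ)(Δ(a)(1 ⊗ y))`: once `y` is absorbed, left invariance leaves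
  -- `φ(a) = 1`.
  have hu : ∀ c y, sliceRight (φ ∘ₗ (LinearMap.mul k A).flip y) (H.T₂ (c ⊗ₜ a)) =
      c * sliceRight φ (H.T₁ (a ⊗ₜ y)) := by
    intro c y
    rw [← sliceRight_lTensor, ← T₁_mul_eq_mul_T₂ hA, sliceRight_rTensor]
    rfl
  refine ⟨δ.left a, φ ∘ₗ g, fun y => (φ ∘ₗ (LinearMap.mul k A).flip y) ∘ₗ g,
    fun y => sliceRight φ (H.T₁ (a ⊗ₜ y)), fun c => ?_, fun y c => ?_, fun x => ?_, fun x => ?_⟩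
  · rw [T₂_modular hA hφ.1 hδmem hδ, sliceRight_lTensor, LinearMap.comp_assoc, hg,
      LinearMap.comp_id, sliceRight_T₂ hA hφ, ha, one_smul]
  · rw [T₂_modular hA hφ.1 hδmem hδ, sliceRight_lTensor, LinearMap.comp_assoc, hg,
      LinearMap.comp_id, hu]
  -- `u_y x` is a slice of `Δ(a)(x ⊗ y)`; it equals `φ(a) x` as soon as `y` is a right unit for the
  -- second leg of `Δ(a)(x ⊗ 1)`.
  · filter_upwards [eventually_lTensor_eq (F := fun y => (LinearMap.mul k A).flip y)
      eventually_rightUnits (H'.T₄ (x ⊗ₜ a))] with y hy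
    change (LinearMap.mul k A).flip x (sliceRight φ (H.T₁ (a ⊗ₜ y))) = x
    rw [← sliceRight_rTensor, T₁_mul_eq_T₄_mul hA hH, hy, sliceRight_T₄ hA hH hφ, ha, one_smul]
  · filter_upwards [eventually_lTensor_eq (F := fun y => (LinearMap.mul k A).flip y)
      eventually_rightUnits (H.T₂ (x ⊗ₜ a))] with y hy
    rw [← hu, ← sliceRight_lTensor, hy, sliceRight_T₂ hA hφ, ha, one_smul]

end Integral

end Hopf

/-! ### The actions of `A` and `B` on `A #_{RT} B` -/

section LinearActions

variable {k A B : Type*} [Field k] [NonUnitalRing A] [Module k A] [NonUnitalRing B] [Module k B]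

/-- The left action `T (b ⊗ y) ↦ T (m b ⊗ y)`. -/
def actAL (T : A ⊗[k] B ≃ₗ[k] A ⊗[k] B) (m : A →ₗ[k] A) : A ⊗[k] B →ₗ[k] A ⊗[k] B :=
  T.toLinearMap ∘ₗ m.rTensor B ∘ₗ T.symm.toLinearMap

/-- The right action `T (b ⊗ y) ↦ T (b ⊗ y n)`. -/
def actBR (T : A ⊗[k] B ≃ₗ[k] A ⊗[k] B) (n : B →ₗ[k] B) : A ⊗[k] B →ₗ[k] A ⊗[k] B :=
  T.toLinearMap ∘ₗ n.lTensor A ∘ₗ T.symm.toLinearMap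

/-- The right action `R (y ⊗ b) ↦ R (y ⊗ b m)`. -/
def actAR (R : B ⊗[k] A ≃ₗ[k] A ⊗[k] B) (m : A →ₗ[k] A) : A ⊗[k] B →ₗ[k] A ⊗[k] B :=
  R.toLinearMap ∘ₗ m.lTensor B ∘ₗ R.symm.toLinearMap

/-- The left action `R (y ⊗ b) ↦ R (n y ⊗ b)`. -/
def actBL (R : B ⊗[k] A ≃ₗ[k] A ⊗[k] B) (n : B →ₗ[k] B) : A ⊗[k] B →ₗ[k] A ⊗[k] B :=
  R.toLinearMap ∘ₗ n.rTensor A ∘ₗ R.symm.toLinearMap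

variable (R : B ⊗[k] A ≃ₗ[k] A ⊗[k] B) (T : A ⊗[k] B ≃ₗ[k] A ⊗[k] B)

@[simp] theorem actAL_apply (m : A →ₗ[k] A) (w : A ⊗[k] B) :
    actAL T m (T w) = T (m.rTensor B w) := by simp [actAL]

@[simp] theorem actBR_apply (n : B →ₗ[k] B) (w : A ⊗[k] B) :
    actBR T n (T w) = T (n.lTensor A w) := by simp [actBR]

@[simp] theorem actAR_apply (m : A →ₗ[k] A) (w : B ⊗[k] A) :
    actAR R m (R w) = R (m.lTensor B w) := by simp [actAR]

@[simp] theorem actBL_apply (n : B →ₗ[k] B) (w : B ⊗[k] A) :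
    actBL R n (R w) = R (n.rTensor A w) := by simp [actBL]

/-- In the coordinates given by `T` the two actions touch different tensor factors; likewise for
`actBL_actAR` and `R`. -/
theorem actAL_actBR (m : A →ₗ[k] A) (n : B →ₗ[k] B) (w : A ⊗[k] B) :
    actAL T m (actBR T n w) = actBR T n (actAL T m w) := by
  obtain ⟨w, rfl⟩ := T.surjective w
  rw [actBR_apply, actAL_apply, actAL_apply, actBR_apply, ← LinearMap.comp_apply,
    ← LinearMap.comp_apply, LinearMap.rTensor_comp_lTensor, LinearMap.lTensor_comp_rTensor]

theorem actBL_actAR (m : A →ₗ[k] A) (n : B →ₗ[k] B) (w : A ⊗[k] B) :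
    actBL R n (actAR R m w) = actAR R m (actBL R n w) := by
  obtain ⟨w, rfl⟩ := R.surjective w
  rw [actAR_apply, actBL_apply, actBL_apply, actAR_apply, ← LinearMap.comp_apply,
    ← LinearMap.comp_apply, LinearMap.rTensor_comp_lTensor, LinearMap.lTensor_comp_rTensor]

theorem T13AA_tmul (a c : A) (d : B) :
    T13AA T (a ⊗ₜ (c ⊗ₜ d)) = TensorProduct.leftComm k A A B (c ⊗ₜ T (a ⊗ₜ d)) := by
  simp [T13AA]

theorem T13AB_tmul (c : A) (d x : B) :
    T13AB T ((c ⊗ₜ d) ⊗ₜ x) = TensorProduct.rightComm k A B B (T (c ⊗ₜ x) ⊗ₜ d) := by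
  simp [T13AB]

variable {R T} {ι : Type*} {l : Filter ι}

theorem eventually_actAL_eq {F : ι → A →ₗ[k] A} (hF : ∀ v, ∀ᶠ i in l, F i v = v)
    (p : A ⊗[k] B) : ∀ᶠ i in l, actAL T (F i) p = p := by
  obtain ⟨t, rfl⟩ := T.surjective p
  filter_upwards [eventually_rTensor_eq hF t] with i hi
  rw [actAL_apply, hi]

theorem eventually_actBR_eq {F : ι → B →ₗ[k] B} (hF : ∀ v, ∀ᶠ i in l, F i v = v)
    (p : A ⊗[k] B) : ∀ᶠ i in l, actBR T (F i) p = p := by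
  obtain ⟨t, rfl⟩ := T.surjective p
  filter_upwards [eventually_lTensor_eq hF t] with i hi
  rw [actBR_apply, hi]

theorem eventually_actAR_eq {F : ι → A →ₗ[k] A} (hF : ∀ v, ∀ᶠ i in l, F i v = v)
    (p : A ⊗[k] B) : ∀ᶠ i in l, actAR R (F i) p = p := by
  obtain ⟨t, rfl⟩ := R.surjective p
  filter_upwards [eventually_lTensor_eq hF t] with i hi
  rw [actAR_apply, hi]

theorem eventually_actBL_eq {F : ι → B →ₗ[k] B} (hF : ∀ v, ∀ᶠ i in l, F i v = v)
    (p : A ⊗[k] B) : ∀ᶠ i in l, actBL R (F i) p = p := by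
  obtain ⟨t, rfl⟩ := R.surjective p
  filter_upwards [eventually_rTensor_eq hF t] with i hi
  rw [actBL_apply, hi]

end LinearActions

section Actions

variable {k A B : Type*} [Field k]
  [NonUnitalRing A] [Module k A] [IsScalarTower k A A] [SMulCommClass k A A]
  [NonUnitalRing B] [Module k B] [IsScalarTower k B B] [SMulCommClass k B B]
  {R : B ⊗[k] A ≃ₗ[k] A ⊗[k] B} {T : A ⊗[k] B ≃ₗ[k] A ⊗[k] B}

/-- The map `c ⊗ d ↦ a_T c ⊗ d_T` satisfies the equation that defines the action on the image of
`T`, by multiplicativity of `T`; surjectivity of `T` finishes. The next three lemmas follow the same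
pattern. -/
theorem IsTwistingPair.actAL_mul (h : IsTwistingPair R T) (a c : A) (d : B) :
    actAL T (LinearMap.mul k A a) (c ⊗ₜ d) =
      ((LinearMap.mul k A).flip c).rTensor B (T (a ⊗ₜ d)) := by
  set E : A ⊗[k] B →ₗ[k] A ⊗[k] B := (LinearMap.mul' k A).rTensor B ∘ₗ
    (TensorProduct.assoc k A A B).symm.toLinearMap ∘ₗ T13AA T ∘ₗ
    TensorProduct.mk k A (A ⊗[k] B) a with hE
  have e₁ : ∀ t, E (T t) = T ((LinearMap.mul k A a).rTensor B t) := by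
    intro t
    induction t with
    | zero => simp
    | add x y hx hy => simp only [map_add, hx, hy]
    | tmul b y => exact (LinearMap.congr_fun h.T_mul_left (a ⊗ₜ (b ⊗ₜ y))).symm
  have e₂ : actAL T (LinearMap.mul k A a) (c ⊗ₜ d) = E (c ⊗ₜ d) := by
    obtain ⟨t, ht⟩ := T.surjective (c ⊗ₜ d)
    rw [← ht, e₁, actAL_apply]
  rw [e₂, hE]
  simp only [LinearMap.comp_apply, TensorProduct.mk_apply, T13AA_tmul]
  induction T (a ⊗ₜ d) with
  | zero => simp
  | tmul p q => simp
  | add x y hx hy => simp only [map_add, TensorProduct.tmul_add, hx, hy]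

theorem IsTwistingPair.actBR_mul (h : IsTwistingPair R T) (x : B) (c : A) (d : B) :
    actBR T ((LinearMap.mul k B).flip x) (c ⊗ₜ d) =
      (LinearMap.mul k B d).lTensor A (T (c ⊗ₜ x)) := by
  set E : A ⊗[k] B →ₗ[k] A ⊗[k] B := (LinearMap.mul' k B).lTensor A ∘ₗ
    (TensorProduct.assoc k A B B).toLinearMap ∘ₗ T13AB T ∘ₗ
    (TensorProduct.mk k (A ⊗[k] B) B).flip x with hE
  have e₁ : ∀ t, E (T t) = T (((LinearMap.mul k B).flip x).lTensor A t) := by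
    intro t
    induction t with
    | zero => simp
    | add x y hx hy => simp only [map_add, hx, hy]
    | tmul b y => exact (LinearMap.congr_fun h.T_mul_right ((b ⊗ₜ y) ⊗ₜ x)).symm
  have e₂ : actBR T ((LinearMap.mul k B).flip x) (c ⊗ₜ d) = E (c ⊗ₜ d) := by
    obtain ⟨t, ht⟩ := T.surjective (c ⊗ₜ d)
    rw [← ht, e₁, actBR_apply]
  rw [e₂, hE]
  simp only [LinearMap.comp_apply, LinearMap.flip_apply, TensorProduct.mk_apply, T13AB_tmul]
  induction T (c ⊗ₜ x) with
  | zero => simp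
  | tmul p q => simp
  | add x y hx hy => simp only [map_add, TensorProduct.add_tmul, hx, hy]

theorem IsTwistingPair.actAR_mul (h : IsTwistingPair R T) (a c : A) (d : B) :
    actAR R ((LinearMap.mul k A).flip a) (c ⊗ₜ d) =
      (LinearMap.mul k A c).rTensor B (R (d ⊗ₜ a)) := by
  set E : A ⊗[k] B →ₗ[k] A ⊗[k] B := (LinearMap.mul' k A).rTensor B ∘ₗ
    (TensorProduct.assoc k A A B).symm.toLinearMap ∘ₗ R.toLinearMap.lTensor A ∘ₗ
    (TensorProduct.assoc k A B A).toLinearMap ∘ₗ (TensorProduct.mk k (A ⊗[k] B) A).flip a with hE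
  have e₁ : ∀ t, E (R t) = R (((LinearMap.mul k A).flip a).lTensor B t) := by
    intro t
    induction t with
    | zero => simp
    | add x y hx hy => simp only [map_add, hx, hy]
    | tmul y b => exact (LinearMap.congr_fun h.R_mul_right ((y ⊗ₜ b) ⊗ₜ a)).symm
  have e₂ : actAR R ((LinearMap.mul k A).flip a) (c ⊗ₜ d) = E (c ⊗ₜ d) := by
    obtain ⟨t, ht⟩ := R.surjective (c ⊗ₜ d)
    rw [← ht, e₁, actAR_apply]
  rw [e₂, hE]
  simp only [LinearMap.comp_apply, LinearMap.flip_apply, TensorProduct.mk_apply,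
    LinearEquiv.coe_coe, TensorProduct.assoc_tmul, LinearMap.lTensor_tmul]
  induction R (d ⊗ₜ a) with
  | zero => simp
  | tmul p q => simp
  | add x y hx hy => simp only [map_add, TensorProduct.tmul_add, hx, hy]

theorem IsTwistingPair.actBL_mul (h : IsTwistingPair R T) (x : B) (c : A) (d : B) :
    actBL R (LinearMap.mul k B x) (c ⊗ₜ d) =
      ((LinearMap.mul k B).flip d).lTensor A (R (x ⊗ₜ c)) := by
  set E : A ⊗[k] B →ₗ[k] A ⊗[k] B := (LinearMap.mul' k B).lTensor A ∘ₗ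
    (TensorProduct.assoc k A B B).toLinearMap ∘ₗ R.toLinearMap.rTensor B ∘ₗ
    (TensorProduct.assoc k B A B).symm.toLinearMap ∘ₗ TensorProduct.mk k B (A ⊗[k] B) x with hE
  have e₁ : ∀ t, E (R t) = R ((LinearMap.mul k B x).rTensor A t) := by
    intro t
    induction t with
    | zero => simp
    | add x y hx hy => simp only [map_add, hx, hy]
    | tmul y b => exact (LinearMap.congr_fun h.R_mul_left ((x ⊗ₜ y) ⊗ₜ b)).symm
  have e₂ : actBL R (LinearMap.mul k B x) (c ⊗ₜ d) = E (c ⊗ₜ d) := by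
    obtain ⟨t, ht⟩ := R.surjective (c ⊗ₜ d)
    rw [← ht, e₁, actBL_apply]
  rw [e₂, hE]
  simp only [LinearMap.comp_apply, TensorProduct.mk_apply, LinearEquiv.coe_coe,
    TensorProduct.assoc_symm_tmul, LinearMap.rTensor_tmul]
  induction R (x ⊗ₜ c) with
  | zero => simp
  | tmul p q => simp
  | add x y hx hy => simp only [map_add, TensorProduct.add_tmul, hx, hy]

/-- Both sides are `a_T c a'_R` tensored with the result of applying `T` and `R` to the same `d`, in
the two orders; `comm_B` identifies them. -/
theorem IsTwistingPair.actAL_actAR (h : IsTwistingPair R T) (a a' : A) (w : A ⊗[k] B) :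
    actAL T (LinearMap.mul k A a) (actAR R ((LinearMap.mul k A).flip a') w) =
      actAR R ((LinearMap.mul k A).flip a') (actAL T (LinearMap.mul k A a) w) := by
  induction w with
  | zero => simp
  | add x y hx hy => simp only [map_add, hx, hy]
  | tmul c d =>
    set P : A ⊗[k] (A ⊗[k] B) →ₗ[k] A ⊗[k] B := (LinearMap.mul' k A).rTensor B ∘ₗ
      (TensorProduct.assoc k A A B).symm.toLinearMap ∘ₗ
      ((LinearMap.mul k A).flip c).rTensor (A ⊗[k] B) with hP
    have e₁ : ∀ t, actAR R ((LinearMap.mul k A).flip a')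
        (((LinearMap.mul k A).flip c).rTensor B t) =
        P (R.toLinearMap.lTensor A (TensorProduct.assoc k A B A (t ⊗ₜ a'))) := by
      intro t
      induction t with
      | zero => simp
      | add x y hx hy => simp only [map_add, TensorProduct.add_tmul, hx, hy]
      | tmul α δ =>
        simp only [LinearMap.rTensor_tmul, h.actAR_mul, TensorProduct.assoc_tmul,
          LinearMap.lTensor_tmul, hP, LinearMap.comp_apply, LinearEquiv.coe_coe]
        induction R (δ ⊗ₜ a') with
        | zero => simp
        | tmul p q => simp
        | add x y hx hy => simp only [map_add, TensorProduct.tmul_add, hx, hy]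
    have e₂ : ∀ r, actAL T (LinearMap.mul k A a) ((LinearMap.mul k A c).rTensor B r) =
        P (T13AA T (a ⊗ₜ r)) := by
      intro r
      induction r with
      | zero => simp
      | add x y hx hy => simp only [map_add, TensorProduct.tmul_add, hx, hy]
      | tmul γ β =>
        simp only [LinearMap.rTensor_tmul, h.actAL_mul, T13AA_tmul, hP, LinearMap.comp_apply]
        induction T (a ⊗ₜ β) with
        | zero => simp
        | tmul p q => simp [mul_assoc]
        | add x y hx hy => simp only [map_add, TensorProduct.tmul_add, hx, hy]
    rw [h.actAL_mul, h.actAR_mul, e₁, e₂]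
    exact congrArg P (LinearMap.congr_fun h.comm_B ((a ⊗ₜ d) ⊗ₜ a')).symm

/-- As for `actAL_actAR`, with both twists now applied to the same `c`; here `comm_A` is the reason.
-/
theorem IsTwistingPair.actBL_actBR (h : IsTwistingPair R T) (x x' : B) (w : A ⊗[k] B) :
    actBL R (LinearMap.mul k B x) (actBR T ((LinearMap.mul k B).flip x') w) =
      actBR T ((LinearMap.mul k B).flip x') (actBL R (LinearMap.mul k B x) w) := by
  induction w with
  | zero => simp
  | add x y hx hy => simp only [map_add, hx, hy]
  | tmul c d =>
    set P : (A ⊗[k] B) ⊗[k] B →ₗ[k] A ⊗[k] B := (LinearMap.mul' k B).lTensor A ∘ₗ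
      (TensorProduct.assoc k A B B).toLinearMap ∘ₗ
      (LinearMap.mul k B d).lTensor (A ⊗[k] B) with hP
    have e₁ : ∀ t, actBL R (LinearMap.mul k B x) ((LinearMap.mul k B d).lTensor A t) =
        P (R.toLinearMap.rTensor B ((TensorProduct.assoc k B A B).symm (x ⊗ₜ t))) := by
      intro t
      induction t with
      | zero => simp
      | add x y hx hy => simp only [map_add, TensorProduct.tmul_add, hx, hy]
      | tmul γ β =>
        simp only [LinearMap.lTensor_tmul, h.actBL_mul, TensorProduct.assoc_symm_tmul,
          LinearMap.rTensor_tmul, hP, LinearMap.comp_apply, LinearEquiv.coe_coe]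
        induction R (x ⊗ₜ γ) with
        | zero => simp
        | tmul p q => simp
        | add x y hx hy => simp only [map_add, TensorProduct.add_tmul, hx, hy]
    have e₂ : ∀ r, actBR T ((LinearMap.mul k B).flip x')
        (((LinearMap.mul k B).flip d).lTensor A r) = P (T13AB T (r ⊗ₜ x')) := by
      intro r
      induction r with
      | zero => simp
      | add x y hx hy => simp only [map_add, TensorProduct.add_tmul, hx, hy]
      | tmul γ β =>
        simp only [LinearMap.lTensor_tmul, h.actBR_mul, T13AB_tmul, hP, LinearMap.comp_apply]
        induction T (γ ⊗ₜ x') with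
        | zero => simp
        | tmul p q => simp [mul_assoc]
        | add x y hx hy => simp only [map_add, TensorProduct.add_tmul, hx, hy]
    rw [h.actBR_mul, h.actBL_mul, e₁, e₂]
    exact congrArg P (LinearMap.congr_fun h.comm_A ((x ⊗ₜ c) ⊗ₜ x'))

/-! ### The product of `A #_{RT} B` -/

theorem twistedMul_tmul_tmul (a c : A) (b d : B) :
    twistedMul R T (a ⊗ₜ b) (c ⊗ₜ d) =
      TensorProduct.map₂ (LinearMap.mul k A) (LinearMap.mul k B).flip
        (T (a ⊗ₜ d)) (R (b ⊗ₜ c)) := by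
  simp only [twistedMul, TensorProduct.curry_apply, LinearMap.comp_apply, LinearEquiv.coe_coe,
    LinearMap.lTensor_tmul, TensorProduct.comm_tmul, TensorProduct.tensorTensorTensorComm_tmul,
    TensorProduct.map_tmul]
  induction T (a ⊗ₜ d) with
  | zero => simp
  | add x y hx hy => simp only [map_add, TensorProduct.add_tmul, LinearMap.add_apply, hx, hy]
  | tmul p q =>
    induction R (b ⊗ₜ c) with
    | zero => simp
    | add x y hx hy => simp only [map_add, TensorProduct.tmul_add, hx, hy]
    | tmul r s => simp

theorem map₂_mul_tmul (u : A ⊗[k] B) (c : A) (d : B) :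
    TensorProduct.map₂ (LinearMap.mul k A) (LinearMap.mul k B).flip u (c ⊗ₜ d) =
      ((LinearMap.mul k A).flip c).rTensor B ((LinearMap.mul k B d).lTensor A u) := by
  induction u with
  | zero => simp
  | tmul p q => simp
  | add x y hx hy => simp only [map_add, LinearMap.add_apply, hx, hy]

/-- Expresses `T(a ⊗ x) = (a # 1)(1 # x)` from the left; `mul_T_eq` is its right version. The
condition `comm_B` lets `R` act before `T`, and multiplicativity of `T` then collects the second
factor. -/
theorem IsTwistingPair.T_mul_eq (h : IsTwistingPair R T) (a : A) (x : B) (p : A ⊗[k] B) :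
    twistedMul R T (T (a ⊗ₜ x)) p =
      actAL T (LinearMap.mul k A a) (actBL R (LinearMap.mul k B x) p) := by
  induction p with
  | zero => simp
  | add x y hx hy => simp only [map_add, hx, hy]
  | tmul c d =>
    set N : A ⊗[k] (A ⊗[k] B) →ₗ[k] A ⊗[k] B := TensorProduct.lift
      (TensorProduct.map₂ (LinearMap.mul k A) (LinearMap.mul k B).flip ∘ₗ T.toLinearMap ∘ₗ
        (TensorProduct.mk k A B).flip d) with hN
    have e₁ : ∀ t, twistedMul R T t (c ⊗ₜ d) =
        N (R.toLinearMap.lTensor A (TensorProduct.assoc k A B A (t ⊗ₜ c))) := by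
      intro t
      induction t with
      | zero => simp
      | add x y hx hy => simp only [map_add, TensorProduct.add_tmul, LinearMap.add_apply, hx, hy]
      | tmul α ξ => rw [twistedMul_tmul_tmul]; simp [hN]
    have e₂ : ∀ r, N (T13AA T (a ⊗ₜ r)) = actAL T (LinearMap.mul k A a)
        (((LinearMap.mul k B).flip d).lTensor A r) := by
      intro r
      induction r with
      | zero => simp
      | add x y hx hy => simp only [map_add, TensorProduct.tmul_add, hx, hy]
      | tmul γ β =>
        have e₃ : T (a ⊗ₜ (β * d)) = actBR T ((LinearMap.mul k B).flip d) (T (a ⊗ₜ β)) := by simp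
        simp only [LinearMap.lTensor_tmul, h.actAL_mul, T13AA_tmul, LinearMap.flip_apply,
          LinearMap.mul_apply', e₃]
        induction T (a ⊗ₜ β) with
        | zero => simp
        | add x y hx hy => simp only [map_add, TensorProduct.tmul_add, hx, hy]
        | tmul p q =>
          rw [h.actBR_mul, TensorProduct.leftComm_tmul]
          simp [hN, map₂_mul_tmul]
    rw [h.actBL_mul, e₁, ← e₂]
    exact congrArg N (LinearMap.congr_fun h.comm_B ((a ⊗ₜ x) ⊗ₜ c))

theorem IsTwistingPair.mul_T_eq (h : IsTwistingPair R T) (a : A) (x : B) (p : A ⊗[k] B) :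
    twistedMul R T p (T (a ⊗ₜ x)) = actBR T ((LinearMap.mul k B).flip x)
      (actAR R ((LinearMap.mul k A).flip a) p) := by
  induction p with
  | zero => simp
  | add x y hx hy => simp only [map_add, LinearMap.add_apply, hx, hy]
  | tmul c d =>
    set N : (A ⊗[k] B) ⊗[k] B →ₗ[k] A ⊗[k] B := TensorProduct.lift
      (TensorProduct.map₂ (LinearMap.mul k A) (LinearMap.mul k B).flip ∘ₗ T.toLinearMap ∘ₗ
        TensorProduct.mk k A B c).flip with hN
    have e₁ : ∀ t, twistedMul R T (c ⊗ₜ d) t =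
        N (R.toLinearMap.rTensor B ((TensorProduct.assoc k B A B).symm (d ⊗ₜ t))) := by
      intro t
      induction t with
      | zero => simp
      | add x y hx hy => simp only [map_add, TensorProduct.tmul_add, hx, hy]
      | tmul α ξ => rw [twistedMul_tmul_tmul]; simp [hN]
    have e₂ : ∀ r, N (T13AB T (r ⊗ₜ x)) = actBR T ((LinearMap.mul k B).flip x)
        ((LinearMap.mul k A c).rTensor B r) := by
      intro r
      induction r with
      | zero => simp
      | add x y hx hy => simp only [map_add, TensorProduct.add_tmul, hx, hy]
      | tmul γ β =>
        have e₃ : T ((c * γ) ⊗ₜ x) = actAL T (LinearMap.mul k A c) (T (γ ⊗ₜ x)) := by simp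
        simp only [LinearMap.rTensor_tmul, h.actBR_mul, T13AB_tmul, LinearMap.mul_apply', e₃]
        induction T (γ ⊗ₜ x) with
        | zero => simp
        | add x y hx hy => simp only [map_add, TensorProduct.add_tmul, hx, hy]
        | tmul p q =>
          rw [h.actAL_mul, TensorProduct.rightComm_tmul, ← LinearMap.comp_apply,
            LinearMap.lTensor_comp_rTensor, ← LinearMap.rTensor_comp_lTensor]
          simp only [hN, TensorProduct.lift.tmul, LinearMap.flip_apply, LinearMap.comp_apply,
            TensorProduct.mk_apply, LinearEquiv.coe_coe, map₂_mul_tmul]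
    rw [h.actAR_mul, e₁, ← e₂]
    exact congrArg N (LinearMap.congr_fun h.comm_A ((d ⊗ₜ a) ⊗ₜ x))

/-- Expresses `R(x ⊗ a) = (1 # x)(a # 1)`, the opposite order to `T`. It lets the product formula
for `Δ_{RT}(R(x ⊗ a))` recombine into elements of `A # B`. -/
theorem IsTwistingPair.mul_R_eq (h : IsTwistingPair R T) (a : A) (x : B) (p : A ⊗[k] B) :
    twistedMul R T p (R (x ⊗ₜ a)) = actAR R ((LinearMap.mul k A).flip a)
      (actBR T ((LinearMap.mul k B).flip x) p) := by
  induction p with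
  | zero => simp
  | add x y hx hy => simp only [map_add, LinearMap.add_apply, hx, hy]
  | tmul c d =>
    set N : A ⊗[k] (A ⊗[k] B) →ₗ[k] A ⊗[k] B := TensorProduct.lift
      (TensorProduct.map₂ (LinearMap.mul k A) (LinearMap.mul k B).flip) ∘ₗ
      (R.toLinearMap ∘ₗ TensorProduct.mk k B A d).lTensor (A ⊗[k] B) ∘ₗ
      (TensorProduct.comm k A (A ⊗[k] B)).toLinearMap ∘ₗ
      (TensorProduct.leftComm k A A B).toLinearMap with hN
    have e₁ : ∀ t, twistedMul R T (c ⊗ₜ d) t = N (T13AA T (c ⊗ₜ t)) := by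
      intro t
      induction t with
      | zero => simp
      | add x y hx hy => simp only [map_add, TensorProduct.tmul_add, hx, hy]
      | tmul α ξ =>
        rw [twistedMul_tmul_tmul, T13AA_tmul]
        induction T (c ⊗ₜ ξ) with
        | zero => simp
        | add x y hx hy => simp only [map_add, TensorProduct.tmul_add, LinearMap.add_apply, hx, hy]
        | tmul p q => simp [hN]
    have e₂ : ∀ r, N (R.toLinearMap.lTensor A (TensorProduct.assoc k A B A (r ⊗ₜ a))) =
        actAR R ((LinearMap.mul k A).flip a) ((LinearMap.mul k B d).lTensor A r) := by
      intro r
      induction r with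
      | zero => simp
      | add x y hx hy => simp only [map_add, TensorProduct.add_tmul, hx, hy]
      | tmul γ β =>
        have e₃ : R ((d * β) ⊗ₜ a) = actBL R (LinearMap.mul k B d) (R (β ⊗ₜ a)) := by simp
        simp only [LinearMap.lTensor_tmul, h.actAR_mul, LinearMap.mul_apply', e₃,
          TensorProduct.assoc_tmul, LinearEquiv.coe_coe]
        induction R (β ⊗ₜ a) with
        | zero => simp
        | add x y hx hy => simp only [map_add, TensorProduct.tmul_add, hx, hy]
        | tmul p q =>
          rw [h.actBL_mul]
          simp only [hN, LinearMap.comp_apply, LinearEquiv.coe_coe, TensorProduct.leftComm_tmul,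
            TensorProduct.comm_tmul, LinearMap.lTensor_tmul, TensorProduct.mk_apply,
            TensorProduct.lift.tmul]
          induction R (d ⊗ₜ p) with
          | zero => simp
          | add x y hx hy => simp only [map_add, hx, hy]
          | tmul r s => simp
    rw [h.actBR_mul, e₁, ← e₂]
    exact congrArg N (LinearMap.congr_fun h.comm_B ((c ⊗ₜ x) ⊗ₜ a)).symm

/-- Left multiplication by `T(a ⊗ x)` is a composite of left actions, right multiplication by `T(b ⊗
y)` one of right actions, and all four left-right pairs commute. -/
theorem IsTwistingPair.isAssociative (h : IsTwistingPair R T) :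
    IsAssociative (twistedMul R T) := by
  intro p q r
  obtain ⟨p, rfl⟩ := T.surjective p
  obtain ⟨r, rfl⟩ := T.surjective r
  induction p with
  | zero => simp
  | add x y hx hy => simp only [map_add, LinearMap.add_apply, hx, hy]
  | tmul a x =>
    induction r with
    | zero => simp
    | add x y hx hy => simp only [map_add, hx, hy]
    | tmul b y =>
      rw [h.T_mul_eq, h.T_mul_eq, h.mul_T_eq, h.mul_T_eq, h.actBL_actBR, actAL_actBR,
        actBL_actAR, h.actAL_actAR]

/-! ### Local units of `A #_{RT} B` -/

/-- The unit is `T(e ⊗ f) = (e # 1)(1 # f)` and not `e # f`, whose convergence is a separate matter.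
-/
theorem IsTwistingPair.eventually_T_mul (h : IsTwistingPair R T) (p : A ⊗[k] B) :
    ∀ᶠ i in leftUnits A ×ˢ leftUnits B, twistedMul R T (T (i.1 ⊗ₜ i.2)) p = p := by
  filter_upwards [(eventually_actAL_eq (T := T) (F := fun e => LinearMap.mul k A e)
      eventually_leftUnits p).prod_inl _,
    (eventually_actBL_eq (R := R) (F := fun e => LinearMap.mul k B e)
      eventually_leftUnits p).prod_inr _] with i h₁ h₂
  rw [h.T_mul_eq, h₂, h₁]

theorem IsTwistingPair.eventually_mul_T (h : IsTwistingPair R T) (p : A ⊗[k] B) :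
    ∀ᶠ i in rightUnits A ×ˢ rightUnits B, twistedMul R T p (T (i.1 ⊗ₜ i.2)) = p := by
  filter_upwards [(eventually_actAR_eq (R := R) (F := fun e => (LinearMap.mul k A).flip e)
      eventually_rightUnits p).prod_inl _,
    (eventually_actBR_eq (T := T) (F := fun e => (LinearMap.mul k B).flip e)
      eventually_rightUnits p).prod_inr _] with i h₁ h₂
  rw [h.mul_T_eq, h₁, h₂]

theorem IsTwistingPair.isNondegenerate (h : IsTwistingPair R T) (hA : HasLocalUnits A)
    (hB : HasLocalUnits B) : IsNondegenerate (twistedMul R T) := by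
  have := hA.leftUnits_neBot
  have := hA.rightUnits_neBot
  have := hB.leftUnits_neBot
  have := hB.rightUnits_neBot
  exact isNondegenerate_of_units h.eventually_T_mul h.eventually_mul_T

theorem IsTwistingPair.isNondegenerate_tensorMul (h : IsTwistingPair R T) (hA : HasLocalUnits A)
    (hB : HasLocalUnits B) :
    IsNondegenerate (tensorMul (twistedMul R T) (twistedMul R T)) := by
  have := hA.leftUnits_neBot
  have := hA.rightUnits_neBot
  have := hB.leftUnits_neBot
  have := hB.rightUnits_neBot
  exact isNondegenerate_of_units (tensorMul_units_left h.eventually_T_mul h.eventually_T_mul)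
    (tensorMul_units_right h.eventually_mul_T h.eventually_mul_T)

/-- For fixed `e`, the element `R(d ⊗ e)` involves finitely many tensors `γ ⊗ β`, and a large `f`
acts trivially from the right on each `c ⊗ β`. So `p (e # f)` becomes `p (e # 1)`. -/
theorem IsTwistingPair.eventually_mul_tmul (h : IsTwistingPair R T) (p : A ⊗[k] B) (e : A) :
    ∀ᶠ f in rightUnits B,
      twistedMul R T p (e ⊗ₜ f) = actAR R ((LinearMap.mul k A).flip e) p := by
  induction p with
  | zero => simp
  | add x y hx hy =>
    filter_upwards [hx, hy] with f h₁ h₂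
    rw [map_add, map_add, LinearMap.add_apply, h₁, h₂]
  | tmul c d =>
    simp only [twistedMul_tmul_tmul, h.actAR_mul]
    induction R (d ⊗ₜ e) with
    | zero => simp
    | add x y hx hy =>
      filter_upwards [hx, hy] with f h₁ h₂
      rw [map_add, map_add, h₁, h₂]
    | tmul γ β =>
      filter_upwards [eventually_actBR_eq (T := T) (F := fun f => (LinearMap.mul k B).flip f)
        eventually_rightUnits (c ⊗ₜ β)] with f hf
      rw [map₂_mul_tmul, ← h.actBR_mul, hf]
      rfl

/-- If `p (e # f)` is eventually constant, then it is eventually `p`. -/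
theorem IsTwistingPair.eq_of_eventually_mul (h : IsTwistingPair R T) (hA : HasLocalUnits A)
    (hB : HasLocalUnits B) {p s : A ⊗[k] B}
    (hs : ∀ᶠ i in rightUnits A ×ˢ rightUnits B, s = twistedMul R T p (i.1 ⊗ₜ i.2)) : s = p := by
  have := hA.rightUnits_neBot
  have := hB.rightUnits_neBot
  -- An existing double limit can be computed as an iterated one, with `f` growing first.
  have hs' : ∀ᶠ e in rightUnits A, s = actAR R ((LinearMap.mul k A).flip e) p := by
    filter_upwards [hs.curry] with e he
    obtain ⟨f, h₁, h₂⟩ := (he.and (h.eventually_mul_tmul p e)).exists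
    rw [h₁, h₂]
  obtain ⟨e, h₁, h₂⟩ := (hs'.and (eventually_actAR_eq (R := R)
    (F := fun e => (LinearMap.mul k A).flip e) eventually_rightUnits p)).exists
  rw [h₁, h₂]

end Actions

/-- This is `m (v n) = (m v) n`, obtained by cancelling a left factor. -/
theorem IsNondegenerate.left_right_comm {k V : Type*} [Field k] [AddCommGroup V] [Module k V]
    {μ : V →ₗ[k] V →ₗ[k] V} (hμ : IsNondegenerate μ) (hμ' : IsAssociative μ)
    {m n : EndPair k V} (hm : m ∈ multiplierAlgebra μ) (hn : n ∈ multiplierAlgebra μ) (v : V) :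
    m.left (n.right v) = n.right (m.left v) :=
  hμ.eq_of_mul_left fun c => by
    rw [← hm, ← hμ.right_mul_apply hμ' hn, ← hμ.right_mul_apply hμ' hn, hm]

/-! ### The multipliers `M # (1 ⊗ 1)` and `(1 ⊗ 1) # N` -/

section LinearHash

variable {k A B : Type*} [Field k] [NonUnitalRing A] [Module k A] [NonUnitalRing B] [Module k B]

/-- `(b ⊗ b') ⊗ (y ⊗ y') ↦ T (b ⊗ y) ⊗ T (b' ⊗ y')`. -/
def pairT (T : A ⊗[k] B ≃ₗ[k] A ⊗[k] B) :
    (A ⊗[k] A) ⊗[k] (B ⊗[k] B) ≃ₗ[k] (A ⊗[k] B) ⊗[k] (A ⊗[k] B) :=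
  TensorProduct.tensorTensorTensorComm k A A B B ≪≫ₗ TensorProduct.congr T T

/-- `(y ⊗ y') ⊗ (b ⊗ b') ↦ R (y ⊗ b) ⊗ R (y' ⊗ b')`. -/
def pairR (R : B ⊗[k] A ≃ₗ[k] A ⊗[k] B) :
    (B ⊗[k] B) ⊗[k] (A ⊗[k] A) ≃ₗ[k] (A ⊗[k] B) ⊗[k] (A ⊗[k] B) :=
  TensorProduct.tensorTensorTensorComm k B B A A ≪≫ₗ TensorProduct.congr R R

variable {R : B ⊗[k] A ≃ₗ[k] A ⊗[k] B} {T : A ⊗[k] B ≃ₗ[k] A ⊗[k] B}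

@[simp] theorem pairT_tmul (b b' : A) (y y' : B) :
    pairT T ((b ⊗ₜ b') ⊗ₜ (y ⊗ₜ y')) = T (b ⊗ₜ y) ⊗ₜ T (b' ⊗ₜ y') := rfl

@[simp] theorem pairR_tmul (b b' : A) (y y' : B) :
    pairR R ((y ⊗ₜ y') ⊗ₜ (b ⊗ₜ b')) = R (y ⊗ₜ b) ⊗ₜ R (y' ⊗ₜ b') := rfl

theorem hashOne_left (M : EndPair k (A ⊗[k] A)) (t : (A ⊗[k] A) ⊗[k] (B ⊗[k] B)) :
    (hashOne R T M).left (pairT T t) = pairT T (M.left.rTensor _ t) := by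
  obtain ⟨s, rfl⟩ := (pairT T).symm.surjective t
  rw [LinearEquiv.apply_symm_apply]
  rfl

theorem hashOne_right (M : EndPair k (A ⊗[k] A)) (t : (B ⊗[k] B) ⊗[k] (A ⊗[k] A)) :
    (hashOne R T M).right (pairR R t) = pairR R (M.right.lTensor _ t) := by
  obtain ⟨s, rfl⟩ := (pairR R).symm.surjective t
  rw [LinearEquiv.apply_symm_apply]
  rfl

theorem oneHash_left (N : EndPair k (B ⊗[k] B)) (t : (B ⊗[k] B) ⊗[k] (A ⊗[k] A)) :
    (oneHash R T N).left (pairR R t) = pairR R (N.left.rTensor _ t) := by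
  obtain ⟨s, rfl⟩ := (pairR R).symm.surjective t
  rw [LinearEquiv.apply_symm_apply]
  rfl

theorem oneHash_right (N : EndPair k (B ⊗[k] B)) (t : (A ⊗[k] A) ⊗[k] (B ⊗[k] B)) :
    (oneHash R T N).right (pairT T t) = pairT T (N.right.lTensor _ t) := by
  obtain ⟨s, rfl⟩ := (pairT T).symm.surjective t
  rw [LinearEquiv.apply_symm_apply]
  rfl

@[simp] theorem tensorFunctional_tmul (φ : A →ₗ[k] k) (ψ : B →ₗ[k] k) (a : A) (b : B) :
    tensorFunctional φ ψ (a ⊗ₜ b) = φ a * ψ b := rfl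

theorem tensorFunctional_ne_zero {φA : A →ₗ[k] k} {φB : B →ₗ[k] k} (hφA : φA ≠ 0)
    (hφB : φB ≠ 0) :
    tensorFunctional φA φB ≠ 0 := by
  obtain ⟨a, ha⟩ := exists_apply_eq_one hφA
  obtain ⟨x, hx⟩ := exists_apply_eq_one hφB
  intro h
  have := LinearMap.congr_fun h (a ⊗ₜ x)
  simp [ha, hx] at this

end LinearHash

/-! ### Covering in the second factor from the left -/

theorem comul_right_tmul {k A : Type*} [Field k] [NonUnitalRing A] [Module k A]
    [IsScalarTower k A A] [SMulCommClass k A A] {H H' : MultiplierHopf k A}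
    (hA : HasLocalUnits A)
    (hH : ∀ a, (H'.comul a : EndPair k (A ⊗[k] A)) = flipPair (H.comul a : EndPair k (A ⊗[k] A)))
    (a y y' : A) : EndPair.right (H.comul a : EndPair k (A ⊗[k] A)) (y ⊗ₜ y') =
      (LinearMap.mul k A y).rTensor A (H'.T₃ (a ⊗ₜ y')) := by
  have hn := hA.isNondegenerate_tensorMul (k := k)
  refine hn.ofElem_injective ?_
  rw [← hn.ofElem_mul (isAssociative_mul.tensorMul isAssociative_mul) (H.comul a).2,
    ← tensorPair_ofElem_one_mul_one_ofElem, mul_assoc, T₃_spec hH,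
    tensorPair_ofElem_one_mul isAssociative_mul isAssociative_mul hn]

section CoverB

variable {k A B : Type*} [Field k] [NonUnitalRing A] [Module k A]
  [NonUnitalRing B] [Module k B] [IsScalarTower k B B] [SMulCommClass k B B]
  {R : B ⊗[k] A ≃ₗ[k] A ⊗[k] B} {T : A ⊗[k] B ≃ₗ[k] A ⊗[k] B}

/-- `x ↦ p (1 # x)`. -/
def mulRightB (T : A ⊗[k] B ≃ₗ[k] A ⊗[k] B) : A ⊗[k] B →ₗ[k] B →ₗ[k] A ⊗[k] B :=
  LinearMap.mk₂ k (fun p x => actBR T ((LinearMap.mul k B).flip x) p) (fun _ _ _ => map_add _ _ _)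
    (fun _ _ _ => map_smul _ _ _) (fun _ _ _ => by simp [actBR]) fun _ _ _ => by simp [actBR]

theorem mulRightB_apply (p : A ⊗[k] B) (x : B) :
    mulRightB T p x = actBR T ((LinearMap.mul k B).flip x) p := rfl

/-- Isolates the dependence on `q`, which enters only through the products `q (1 # r)`, with `r` a
first leg of `(1 ⊗ y) Δ(x)`. -/
theorem oneHash_comul_right {H H' : MultiplierHopf k B} (hB : HasLocalUnits B)
    (hH : ∀ b, (H'.comul b : EndPair k (B ⊗[k] B)) = flipPair (H.comul b : EndPair k (B ⊗[k] B)))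
    (x y : B) (b : A) (q : A ⊗[k] B) :
    (oneHash R T (H.comul x)).right (q ⊗ₜ T (b ⊗ₜ y)) =
      TensorProduct.map (mulRightB T q) (T.toLinearMap ∘ₗ TensorProduct.mk k A B b)
        (H'.T₃ (x ⊗ₜ y)) := by
  obtain ⟨q, rfl⟩ := T.surjective q
  induction q with
  | zero => simp [TensorProduct.map_zero_left]
  | add p q hp hq =>
    rw [map_add, TensorProduct.add_tmul, map_add, hp, hq, map_add, TensorProduct.map_add_left,
      LinearMap.add_apply]
  | tmul c d =>
    rw [← pairT_tmul, oneHash_right, LinearMap.lTensor_tmul, comul_right_tmul hB hH]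
    induction H'.T₃ (x ⊗ₜ y) with
    | zero => simp
    | tmul r s => simp [mulRightB_apply]
    | add p q hp hq => simp only [map_add, TensorProduct.tmul_add, hp, hq]

end CoverB

section CoverA

variable {k A B : Type*} [Field k] [NonUnitalRing B] [Module k B]
  [NonUnitalRing A] [Module k A] [IsScalarTower k A A] [SMulCommClass k A A]
  {R : B ⊗[k] A ≃ₗ[k] A ⊗[k] B} {T : A ⊗[k] B ≃ₗ[k] A ⊗[k] B}

/-- `a ↦ p (a # 1)`. -/
def mulRightA (R : B ⊗[k] A ≃ₗ[k] A ⊗[k] B) : A ⊗[k] B →ₗ[k] A →ₗ[k] A ⊗[k] B :=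
  LinearMap.mk₂ k (fun p a => actAR R ((LinearMap.mul k A).flip a) p) (fun _ _ _ => map_add _ _ _)
    (fun _ _ _ => map_smul _ _ _) (fun _ _ _ => by simp [actAR]) fun _ _ _ => by simp [actAR]

theorem mulRightA_apply (p : A ⊗[k] B) (a : A) :
    mulRightA R p a = actAR R ((LinearMap.mul k A).flip a) p := rfl

theorem hashOne_comul_right {H H' : MultiplierHopf k A} (hA : HasLocalUnits A)
    (hH : ∀ a, (H'.comul a : EndPair k (A ⊗[k] A)) = flipPair (H.comul a : EndPair k (A ⊗[k] A)))
    (a b : A) (y : B) (q : A ⊗[k] B) :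
    (hashOne R T (H.comul a)).right (q ⊗ₜ R (y ⊗ₜ b)) =
      TensorProduct.map (mulRightA R q) (R.toLinearMap ∘ₗ TensorProduct.mk k B A y)
        (H'.T₃ (a ⊗ₜ b)) := by
  obtain ⟨q, rfl⟩ := R.surjective q
  induction q with
  | zero => simp [TensorProduct.map_zero_left]
  | add p q hp hq =>
    rw [map_add, TensorProduct.add_tmul, map_add, hp, hq, map_add, TensorProduct.map_add_left,
      LinearMap.add_apply]
  | tmul d c =>
    rw [← pairR_tmul, hashOne_right, LinearMap.lTensor_tmul, comul_right_tmul hA hH]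
    induction H'.T₃ (a ⊗ₜ b) with
    | zero => simp
    | tmul r s => simp [mulRightA_apply]
    | add p q hp hq => simp only [map_add, TensorProduct.tmul_add, hp, hq]

end CoverA

/-! ### Multipliers of the tensor square induced from `A ⊗ A` and `B ⊗ B` -/

section Hash

variable {k A B : Type*} [Field k]
  [NonUnitalRing A] [Module k A] [IsScalarTower k A A] [SMulCommClass k A A]
  [NonUnitalRing B] [Module k B] [IsScalarTower k B B] [SMulCommClass k B B]
  {R : B ⊗[k] A ≃ₗ[k] A ⊗[k] B} {T : A ⊗[k] B ≃ₗ[k] A ⊗[k] B}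

/-- In each pair of factors `R(y ⊗ c) T(d ⊗ z) = R(y ⊗ c d)(1 # z)` depends on `c` and `d` only
through `c d`, so `M` may move from one to the other. For `oneHash_mem` the products are `T(b ⊗ y)
R(z ⊗ c) = T(b ⊗ y z)(c # 1)`. -/
theorem IsTwistingPair.hashOne_mem (h : IsTwistingPair R T) {M : EndPair k (A ⊗[k] A)}
    (hM : M ∈ multiplierAlgebra (tensorMul (LinearMap.mul k A) (LinearMap.mul k A))) :
    hashOne R T M ∈ multiplierAlgebra (tensorMul (twistedMul R T) (twistedMul R T)) := by
  have key : ∀ (y y' z z' : B) (α β : A ⊗[k] A),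
      tensorMul (twistedMul R T) (twistedMul R T) (pairR R ((y ⊗ₜ y') ⊗ₜ α))
        (pairT T (β ⊗ₜ (z ⊗ₜ z'))) =
      TensorProduct.map
        (actBR T ((LinearMap.mul k B).flip z) ∘ₗ R.toLinearMap ∘ₗ TensorProduct.mk k B A y)
        (actBR T ((LinearMap.mul k B).flip z') ∘ₗ R.toLinearMap ∘ₗ TensorProduct.mk k B A y')
        (tensorMul (LinearMap.mul k A) (LinearMap.mul k A) α β) := by
    intro y y' z z' α β
    induction α with
    | zero => simp
    | add x y hx hy =>
      simp only [map_add, TensorProduct.tmul_add, LinearMap.add_apply, hx, hy]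
    | tmul c c' =>
      induction β with
      | zero => simp
      | add x y hx hy => simp only [map_add, TensorProduct.add_tmul, hx, hy]
      | tmul d d' => simp [h.mul_T_eq]
  intro w w'
  obtain ⟨w, rfl⟩ := (pairR R).surjective w
  obtain ⟨w', rfl⟩ := (pairT T).surjective w'
  rw [hashOne_left, hashOne_right]
  induction w with
  | zero => simp
  | add x y hx hy => simp only [map_add, LinearMap.add_apply, hx, hy]
  | tmul γ α =>
    induction w' with
    | zero => simp
    | add x y hx hy => simp only [map_add, hx, hy]
    | tmul β ζ =>
      simp only [LinearMap.lTensor_tmul, LinearMap.rTensor_tmul]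
      induction γ with
      | zero => simp
      | add x y hx hy =>
        simp only [TensorProduct.add_tmul, map_add, LinearMap.add_apply, hx, hy]
      | tmul y y' =>
        induction ζ with
        | zero => simp
        | add x y hx hy => simp only [TensorProduct.tmul_add, map_add, hx, hy]
        | tmul z z' => rw [key, key, hM]

theorem IsTwistingPair.oneHash_mem (h : IsTwistingPair R T) {N : EndPair k (B ⊗[k] B)}
    (hN : N ∈ multiplierAlgebra (tensorMul (LinearMap.mul k B) (LinearMap.mul k B))) :
    oneHash R T N ∈ multiplierAlgebra (tensorMul (twistedMul R T) (twistedMul R T)) := by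
  have key : ∀ (b b' c c' : A) (α β : B ⊗[k] B),
      tensorMul (twistedMul R T) (twistedMul R T) (pairT T ((b ⊗ₜ b') ⊗ₜ α))
        (pairR R (β ⊗ₜ (c ⊗ₜ c'))) =
      TensorProduct.map
        (actAR R ((LinearMap.mul k A).flip c) ∘ₗ T.toLinearMap ∘ₗ TensorProduct.mk k A B b)
        (actAR R ((LinearMap.mul k A).flip c') ∘ₗ T.toLinearMap ∘ₗ TensorProduct.mk k A B b')
        (tensorMul (LinearMap.mul k B) (LinearMap.mul k B) α β) := by
    intro b b' c c' α β
    induction α with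
    | zero => simp
    | add x y hx hy =>
      simp only [map_add, TensorProduct.tmul_add, LinearMap.add_apply, hx, hy]
    | tmul y y' =>
      induction β with
      | zero => simp
      | add x y hx hy => simp only [map_add, TensorProduct.add_tmul, hx, hy]
      | tmul z z' => simp [h.mul_R_eq]
  intro w w'
  obtain ⟨w, rfl⟩ := (pairT T).surjective w
  obtain ⟨w', rfl⟩ := (pairR R).surjective w'
  rw [oneHash_left, oneHash_right]
  induction w with
  | zero => simp
  | add x y hx hy => simp only [map_add, LinearMap.add_apply, hx, hy]
  | tmul γ α =>
    induction w' with
    | zero => simp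
    | add x y hx hy => simp only [map_add, hx, hy]
    | tmul β ζ =>
      simp only [LinearMap.lTensor_tmul, LinearMap.rTensor_tmul]
      induction γ with
      | zero => simp
      | add x y hx hy =>
        simp only [TensorProduct.add_tmul, map_add, LinearMap.add_apply, hx, hy]
      | tmul b b' =>
        induction ζ with
        | zero => simp
        | add x y hx hy => simp only [TensorProduct.tmul_add, map_add, hx, hy]
        | tmul c c' => rw [key, key, hN]

/-- `(1 ⊗ p) ((1 ⊗ 1) # Δ(x)) (Δ(a) # (1 ⊗ 1))` lies in `(A #_{RT} B) ⊗ (A #_{RT} B)`. -/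
theorem IsTwistingPair.exists_right_eq (h : IsTwistingPair R T) (hA : HasLocalUnits A)
    (hB : HasLocalUnits B) {HA : MultiplierHopf k A} {HB : MultiplierHopf k B}
    (regA : HA.IsRegular) (regB : HB.IsRegular) (x : B) (a : A) (p : A ⊗[k] B) :
    ∃ w, ∀ q, (oneHash R T (HB.comul x) * hashOne R T (HA.comul a)).right (q ⊗ₜ p) =
      (twistedMul R T q).rTensor (A ⊗[k] B) w := by
  obtain ⟨HA', hHA⟩ := regA
  obtain ⟨HB', hHB⟩ := regB
  have e₁ : ∀ (u : B) (c : A ⊗[k] B), ∃ w, ∀ q,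
      (hashOne R T (HA.comul a)).right (mulRightB T q u ⊗ₜ c) =
        (twistedMul R T q).rTensor (A ⊗[k] B) w := by
    intro u c
    obtain ⟨c, rfl⟩ := R.surjective c
    induction c with
    | zero => exact ⟨0, by simp⟩
    | add c c' hc hc' =>
      obtain ⟨w, hw⟩ := hc
      obtain ⟨w', hw'⟩ := hc'
      exact ⟨w + w', fun q => by rw [map_add, TensorProduct.tmul_add, map_add, map_add, hw, hw']⟩
    | tmul y b =>
      simp only [hashOne_comul_right hA hHA]
      induction HA'.T₃ (a ⊗ₜ b) with
      | zero => exact ⟨0, by simp⟩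
      | add c c' hc hc' =>
        obtain ⟨w, hw⟩ := hc
        obtain ⟨w', hw'⟩ := hc'
        exact ⟨w + w', fun q => by rw [map_add, map_add, hw, hw']⟩
      | tmul s s' =>
        -- The successive factors `1 # u` and `s # 1` of `q` recombine into `R(u ⊗ s)`.
        refine ⟨R (u ⊗ₜ s) ⊗ₜ R (y ⊗ₜ s'), fun q => ?_⟩
        rw [LinearMap.rTensor_tmul, h.mul_R_eq]
        rfl
  -- The factor from `B` acts first and is explicit in `T`-coordinates; its output is re-expanded in
  -- `R`-coordinates by `e₁`.
  obtain ⟨p, rfl⟩ := T.surjective p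
  induction p with
  | zero => exact ⟨0, by simp⟩
  | add c c' hc hc' =>
    obtain ⟨w, hw⟩ := hc
    obtain ⟨w', hw'⟩ := hc'
    exact ⟨w + w', fun q => by rw [map_add, TensorProduct.tmul_add, map_add, map_add, hw, hw']⟩
  | tmul b y =>
    simp only [EndPair.right_mul, LinearMap.comp_apply, oneHash_comul_right hB hHB]
    induction HB'.T₃ (x ⊗ₜ y) with
    | zero => exact ⟨0, by simp⟩
    | add c c' hc hc' =>
      obtain ⟨w, hw⟩ := hc
      obtain ⟨w', hw'⟩ := hc'
      exact ⟨w + w', fun q => by rw [map_add, map_add, map_add, hw, hw']⟩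
    | tmul u u' => exact e₁ u (T (b ⊗ₜ u'))

end Hash

/-! ### The comultiplication of `A #_{RT} B` -/

section Comul

variable {k A B : Type*} [Field k]
  [NonUnitalRing A] [Module k A] [IsScalarTower k A A] [SMulCommClass k A A]
  [NonUnitalRing B] [Module k B] [IsScalarTower k B B] [SMulCommClass k B B]
  {HA : MultiplierHopf k A} {HB : MultiplierHopf k B}
  {R : B ⊗[k] A ≃ₗ[k] A ⊗[k] B} {T : A ⊗[k] B ≃ₗ[k] A ⊗[k] B}

theorem isT1_iff (hA : HasLocalUnits A) (hB : HasLocalUnits B) {z p : A ⊗[k] B}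
    {w : (A ⊗[k] B) ⊗[k] (A ⊗[k] B)} : IsT1 HA HB R T z p w ↔
      ∀ᶠ i in leftUnits A ×ˢ leftUnits B,
        w = ((twistedMul R T).flip p).lTensor (A ⊗[k] B) (coverRight HA HB i.1 i.2 z) :=
  (eventually_leftUnits_prod_iff hA hB (P := fun e f =>
    w = ((twistedMul R T).flip p).lTensor (A ⊗[k] B) (coverRight HA HB e f z))).symm

theorem isT2_iff (hA : HasLocalUnits A) (hB : HasLocalUnits B) {z p : A ⊗[k] B}
    {w : (A ⊗[k] B) ⊗[k] (A ⊗[k] B)} : IsT2 HA HB R T p z w ↔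
      ∀ᶠ i in rightUnits A ×ˢ rightUnits B,
        w = (twistedMul R T p).rTensor (A ⊗[k] B) (coverLeft HA HB i.1 i.2 z) :=
  (eventually_rightUnits_prod_iff hA hB (P := fun e f =>
    w = (twistedMul R T p).rTensor (A ⊗[k] B) (coverLeft HA HB e f z))).symm

theorem isHash_iff (hA : HasLocalUnits A) (hB : HasLocalUnits B) {m : EndPair k A}
    {n : EndPair k B} {v : EndPair k (A ⊗[k] B)} : IsHash R T m n v ↔
      (∀ p, ∀ᶠ i in leftUnits A ×ˢ leftUnits B,
        v.left p = twistedMul R T (m.left i.1 ⊗ₜ n.left i.2) p) ∧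
      ∀ p, ∀ᶠ i in rightUnits A ×ˢ rightUnits B,
        v.right p = twistedMul R T p (m.right i.1 ⊗ₜ n.right i.2) :=
  and_congr
    (forall_congr' fun p => (eventually_leftUnits_prod_iff hA hB (P := fun e f =>
      v.left p = twistedMul R T (m.left e ⊗ₜ n.left f) p)).symm)
    (forall_congr' fun p => (eventually_rightUnits_prod_iff hA hB (P := fun e f =>
      v.right p = twistedMul R T p (m.right e ⊗ₜ n.right f))).symm)

theorem IsComulRT.unique (hA : HasLocalUnits A) (hB : HasLocalUnits B) {z : A ⊗[k] B}
    {Υ Υ' : EndPair k ((A ⊗[k] B) ⊗[k] (A ⊗[k] B))} (h : IsComulRT HA HB R T z Υ)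
    (h' : IsComulRT HA HB R T z Υ') : Υ = Υ' := by
  have := hA.leftUnits_neBot
  have := hA.rightUnits_neBot
  have := hB.leftUnits_neBot
  have := hB.rightUnits_neBot
  refine EndPair.ext (TensorProduct.ext' fun q p => ?_) (TensorProduct.ext' fun q p => ?_)
  · obtain ⟨w, hw, hq⟩ := h.1 p
    obtain ⟨w', hw', hq'⟩ := h'.1 p
    obtain ⟨i, e, e'⟩ := (((isT1_iff hA hB).mp hw).and ((isT1_iff hA hB).mp hw')).exists
    rw [hq, hq', e, e']
  · obtain ⟨w, hw, hp⟩ := h.2 q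
    obtain ⟨w', hw', hp'⟩ := h'.2 q
    obtain ⟨i, e, e'⟩ := (((isT2_iff hA hB).mp hw).and ((isT2_iff hA hB).mp hw')).exists
    rw [hp, hp', e, e']

theorem IsComulRT.add (hA : HasLocalUnits A) (hB : HasLocalUnits B) {z z' : A ⊗[k] B}
    {Υ Υ' : EndPair k ((A ⊗[k] B) ⊗[k] (A ⊗[k] B))} (h : IsComulRT HA HB R T z Υ)
    (h' : IsComulRT HA HB R T z' Υ') : IsComulRT HA HB R T (z + z') (Υ + Υ') := by
  refine ⟨fun p => ?_, fun q => ?_⟩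
  · obtain ⟨w, hw, hq⟩ := h.1 p
    obtain ⟨w', hw', hq'⟩ := h'.1 p
    refine ⟨w + w', (isT1_iff hA hB).mpr ?_, fun q => ?_⟩
    · filter_upwards [(isT1_iff hA hB).mp hw, (isT1_iff hA hB).mp hw'] with i e e'
      rw [map_add, map_add, ← e, ← e']
    · rw [EndPair.left_add, LinearMap.add_apply, map_add, hq, hq']
  · obtain ⟨w, hw, hp⟩ := h.2 q
    obtain ⟨w', hw', hp'⟩ := h'.2 q
    refine ⟨w + w', (isT2_iff hA hB).mpr ?_, fun p => ?_⟩
    · filter_upwards [(isT2_iff hA hB).mp hw, (isT2_iff hA hB).mp hw'] with i e e'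
      rw [map_add, map_add, ← e, ← e']
    · rw [EndPair.right_add, LinearMap.add_apply, map_add, hp, hp']

theorem IsComulRT.smul (hA : HasLocalUnits A) (hB : HasLocalUnits B) {z : A ⊗[k] B}
    {Υ : EndPair k ((A ⊗[k] B) ⊗[k] (A ⊗[k] B))} (h : IsComulRT HA HB R T z Υ) (c : k) :
    IsComulRT HA HB R T (c • z) (c • Υ) := by
  refine ⟨fun p => ?_, fun q => ?_⟩
  · obtain ⟨w, hw, hq⟩ := h.1 p
    refine ⟨c • w, (isT1_iff hA hB).mpr ?_, fun q => ?_⟩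
    · filter_upwards [(isT1_iff hA hB).mp hw] with i e
      rw [map_smul, map_smul, ← e]
    · rw [EndPair.left_smul, LinearMap.smul_apply, map_smul, hq]
  · obtain ⟨w, hw, hp⟩ := h.2 q
    refine ⟨c • w, (isT2_iff hA hB).mpr ?_, fun p => ?_⟩
    · filter_upwards [(isT2_iff hA hB).mp hw] with i e
      rw [map_smul, map_smul, ← e]
    · rw [EndPair.right_smul, LinearMap.smul_apply, map_smul, hp]

theorem isComulRT_zero : IsComulRT HA HB R T 0 0 :=
  ⟨fun p => ⟨0, ⟨0, 0, by simp⟩, by simp⟩, fun q => ⟨0, ⟨0, 0, by simp⟩, by simp⟩⟩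

/-- The definition prescribes `Υ (q ⊗ p) = w (q ⊗ 1)`. Multiplying on the right by `1 ⊗ q'` turns
this into `Υ (1 ⊗ p) = w`, tested on `q ⊗ q'`. -/
theorem IsComulRT.exists_comul_mul (hA : HasLocalUnits A) (hB : HasLocalUnits B)
    (hRT : IsTwistingPair R T) {z : A ⊗[k] B} {Υ : EndPair k ((A ⊗[k] B) ⊗[k] (A ⊗[k] B))}
    (h : IsComulRT HA HB R T z Υ)
    (hΥ : Υ ∈ multiplierAlgebra (tensorMul (twistedMul R T) (twistedMul R T))) (p : A ⊗[k] B) :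
    ∃ w, Υ * tensorPair 1 (ofElem (twistedMul R T) p) =
      ofElem (tensorMul (twistedMul R T) (twistedMul R T)) w ∧ IsT1 HA HB R T z p w := by
  obtain ⟨w, hw, hq⟩ := h.1 p
  have ha := hRT.isAssociative
  have hn := hRT.isNondegenerate_tensorMul hA hB
  refine ⟨w, hn.ext_left (mul_mem hΥ (tensorPair_mem (one_mem _) (ofElem_mem ha p)))
    (ofElem_mem (ha.tensorMul ha) w) (TensorProduct.ext' fun q q' => ?_), hw⟩
  have e := hn.left_right_comm (ha.tensorMul ha) hΥ
    (tensorPair_mem (one_mem _) (ofElem_mem ha q')) (q ⊗ₜ p)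
  rw [hq] at e
  refine e.trans ?_
  rw [ofElem_left, tensorMul_tmul_right, ← LinearMap.lTensor_comp_rTensor]
  rfl

theorem IsComulRT.exists_mul_comul (hA : HasLocalUnits A) (hB : HasLocalUnits B)
    (hRT : IsTwistingPair R T) {z : A ⊗[k] B} {Υ : EndPair k ((A ⊗[k] B) ⊗[k] (A ⊗[k] B))}
    (h : IsComulRT HA HB R T z Υ)
    (hΥ : Υ ∈ multiplierAlgebra (tensorMul (twistedMul R T) (twistedMul R T))) (q : A ⊗[k] B) :
    ∃ w, tensorPair (ofElem (twistedMul R T) q) 1 * Υ =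
      ofElem (tensorMul (twistedMul R T) (twistedMul R T)) w ∧ IsT2 HA HB R T q z w := by
  obtain ⟨w, hw, hp⟩ := h.2 q
  have ha := hRT.isAssociative
  have hn := hRT.isNondegenerate_tensorMul hA hB
  refine ⟨w, hn.ext_right (mul_mem (tensorPair_mem (ofElem_mem ha q) (one_mem _)) hΥ)
    (ofElem_mem (ha.tensorMul ha) w) (TensorProduct.ext' fun s p => ?_), hw⟩
  have e := hn.left_right_comm (ha.tensorMul ha)
    (tensorPair_mem (ofElem_mem ha s) (one_mem _)) hΥ (q ⊗ₜ p)
  rw [hp] at e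
  refine e.symm.trans ?_
  rw [ofElem_right, LinearMap.flip_apply, tensorMul_tmul_left, ← LinearMap.rTensor_comp_lTensor]
  rfl

theorem exists_one_mul_comul (hA : HasLocalUnits A) (hB : HasLocalUnits B)
    (hRT : IsTwistingPair R T) {Υ : EndPair k ((A ⊗[k] B) ⊗[k] (A ⊗[k] B))}
    (hΥ : Υ ∈ multiplierAlgebra (tensorMul (twistedMul R T) (twistedMul R T)))
    {p : A ⊗[k] B}
    (h : ∃ w, ∀ q, Υ.right (q ⊗ₜ p) = (twistedMul R T q).rTensor (A ⊗[k] B) w) :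
    ∃ w, tensorPair 1 (ofElem (twistedMul R T) p) * Υ =
      ofElem (tensorMul (twistedMul R T) (twistedMul R T)) w := by
  obtain ⟨w, hq⟩ := h
  have ha := hRT.isAssociative
  have hn := hRT.isNondegenerate_tensorMul hA hB
  refine ⟨w, hn.ext_right (mul_mem (tensorPair_mem (one_mem _) (ofElem_mem ha p)) hΥ)
    (ofElem_mem (ha.tensorMul ha) w) (TensorProduct.ext' fun q s => ?_)⟩
  have e := hn.left_right_comm (ha.tensorMul ha)
    (tensorPair_mem (one_mem _) (ofElem_mem ha s)) hΥ (q ⊗ₜ p)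
  rw [hq] at e
  refine e.symm.trans ?_
  rw [ofElem_right, LinearMap.flip_apply, tensorMul_tmul_left, ← LinearMap.lTensor_comp_rTensor]
  rfl

/-! ### Slices -/

/-- The covered comultiplication is built separately on `A` and `B`, so a product functional slices
the two parts independently, before any limit is taken. -/
theorem sliceLeft_coverRight (φ : A →ₗ[k] k) (ψ : B →ₗ[k] k) (F : A ⊗[k] B →ₗ[k] A ⊗[k] B)
    (e a : A) (f x : B) :
    sliceLeft (tensorFunctional φ ψ) (F.lTensor (A ⊗[k] B) (coverRight HA HB e f (a ⊗ₜ x))) =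
      F (sliceLeft φ (HA.T₁ (a ⊗ₜ e)) ⊗ₜ sliceLeft ψ (HB.T₁ (x ⊗ₜ f))) := by
  rw [sliceLeft_lTensor]
  congr 1
  simp only [coverRight, LinearMap.comp_apply, TensorProduct.map_tmul, LinearMap.flip_apply,
    TensorProduct.mk_apply, LinearEquiv.coe_coe]
  induction HA.T₁ (a ⊗ₜ e) with
  | zero => simp
  | add x y hx hy => simp only [map_add, TensorProduct.add_tmul, hx, hy]
  | tmul c d =>
    induction HB.T₁ (x ⊗ₜ f) with
    | zero => simp
    | add x y hx hy => simp only [map_add, TensorProduct.tmul_add, hx, hy]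
    | tmul y y' =>
      simp only [TensorProduct.tensorTensorTensorComm_tmul, sliceLeft_tmul, tensorFunctional_tmul,
        TensorProduct.smul_tmul_smul]

theorem sliceRight_coverLeft (φ : A →ₗ[k] k) (ψ : B →ₗ[k] k) (F : A ⊗[k] B →ₗ[k] A ⊗[k] B)
    (e a : A) (f x : B) :
    sliceRight (tensorFunctional φ ψ) (F.rTensor (A ⊗[k] B) (coverLeft HA HB e f (a ⊗ₜ x))) =
      F (sliceRight φ (HA.T₂ (e ⊗ₜ a)) ⊗ₜ sliceRight ψ (HB.T₂ (f ⊗ₜ x))) := by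
  rw [sliceRight_rTensor]
  congr 1
  simp only [coverLeft, LinearMap.comp_apply, TensorProduct.map_tmul,
    TensorProduct.mk_apply, LinearEquiv.coe_coe]
  induction HA.T₂ (e ⊗ₜ a) with
  | zero => simp
  | add x y hx hy => simp only [map_add, TensorProduct.add_tmul, hx, hy]
  | tmul c d =>
    induction HB.T₂ (f ⊗ₜ x) with
    | zero => simp
    | add x y hx hy => simp only [map_add, TensorProduct.tmul_add, hx, hy]
    | tmul y y' =>
      simp only [TensorProduct.tensorTensorTensorComm_tmul, sliceRight_tmul, tensorFunctional_tmul,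
        TensorProduct.smul_tmul_smul]

variable {φA : A →ₗ[k] k} {φB : B →ₗ[k] k} {δA : EndPair k A} {δB : EndPair k B}

theorem sliceLeft_coverRight_modular (hA : HasLocalUnits A) (hB : HasLocalUnits B)
    (hδA : IsModularElement (LinearMap.mul k A) (fun a => HA.comul a) φA δA)
    (hδB : IsModularElement (LinearMap.mul k B) (fun b => HB.comul b) φB δB)
    (F : A ⊗[k] B →ₗ[k] A ⊗[k] B) (e : A) (f : B) (z : A ⊗[k] B) :
    sliceLeft (tensorFunctional φA φB) (F.lTensor (A ⊗[k] B) (coverRight HA HB e f z)) =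
      tensorFunctional φA φB z • F (δA.left e ⊗ₜ δB.left f) := by
  induction z with
  | zero => simp
  | add x y hx hy => simp only [map_add, add_smul, hx, hy]
  | tmul a x =>
    rw [sliceLeft_coverRight, sliceLeft_T₁ hA hδA, sliceLeft_T₁ hB hδB,
      TensorProduct.smul_tmul_smul, map_smul, tensorFunctional_tmul]

theorem sliceRight_coverLeft_integral (hA : HasLocalUnits A) (hB : HasLocalUnits B)
    (hφA : IsLeftIntegral (LinearMap.mul k A) (fun a => HA.comul a) φA)
    (hφB : IsLeftIntegral (LinearMap.mul k B) (fun b => HB.comul b) φB)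
    (F : A ⊗[k] B →ₗ[k] A ⊗[k] B) (e : A) (f : B) (z : A ⊗[k] B) :
    sliceRight (tensorFunctional φA φB) (F.rTensor (A ⊗[k] B) (coverLeft HA HB e f z)) =
      tensorFunctional φA φB z • F (e ⊗ₜ f) := by
  induction z with
  | zero => simp
  | add x y hx hy => simp only [map_add, add_smul, hx, hy]
  | tmul a x =>
    rw [sliceRight_coverLeft, sliceRight_T₂ hA hφA, sliceRight_T₂ hB hφB,
      TensorProduct.smul_tmul_smul, map_smul, tensorFunctional_tmul]

/-- If all the `T₁ (z ⊗ p)` and `T₂ (q ⊗ z)` exist, so does the multiplier `δ_A # δ_B`. -/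
theorem exists_isHash_modular (hA : HasLocalUnits A) (hB : HasLocalUnits B)
    (regA : HA.IsRegular) (regB : HB.IsRegular) (hRT : IsTwistingPair R T)
    (hφA : IsLeftIntegral (LinearMap.mul k A) (fun a => HA.comul a) φA)
    (hφB : IsLeftIntegral (LinearMap.mul k B) (fun b => HB.comul b) φB)
    (hδAmem : δA ∈ multiplierAlgebra (LinearMap.mul k A))
    (hδBmem : δB ∈ multiplierAlgebra (LinearMap.mul k B))
    (hδA : IsModularElement (LinearMap.mul k A) (fun a => HA.comul a) φA δA)
    (hδB : IsModularElement (LinearMap.mul k B) (fun b => HB.comul b) φB δB)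
    (h₁ : ∀ z p, ∃ w, IsT1 HA HB R T z p w) (h₂ : ∀ z q, ∃ w, IsT2 HA HB R T q z w) :
    ∃ u ∈ multiplierAlgebra (twistedMul R T), IsHash R T δA δB u := by
  have := hA.leftUnits_neBot
  have := hA.rightUnits_neBot
  have := hB.leftUnits_neBot
  have := hB.rightUnits_neBot
  have := hA.inf_neBot
  have := hB.inf_neBot
  obtain ⟨a, ha⟩ := exists_apply_eq_one hφA.1
  obtain ⟨x, hx⟩ := exists_apply_eq_one hφB.1
  obtain ⟨a₀, ωA, ωA', uA, hωA, hωA', huA, huA'⟩ :=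
    exists_slices_eq_modular hA regA hφA hδAmem hδA
  obtain ⟨b₀, ωB, ωB', uB, hωB, hωB', huB, huB'⟩ :=
    exists_slices_eq_modular hB regB hφB hδBmem hδB
  -- Left half: slicing `T₁((a # x) ⊗ p)` with `φ_A(a) = φ_B(x) = 1` shows that `(δ_A e # δ_B f) p`
  -- is eventually constant.
  obtain ⟨V, hV⟩ := exists_linear_limit (l := leftUnits A ×ˢ leftUnits B)
    (fun i => twistedMul R T (δA.left i.1 ⊗ₜ δB.left i.2)) fun p => by
      obtain ⟨w, hw⟩ := h₁ (a ⊗ₜ x) p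
      refine ⟨sliceLeft (tensorFunctional φA φB) w, ?_⟩
      filter_upwards [(isT1_iff hA hB).mp hw] with i hi
      rw [hi, sliceLeft_coverRight_modular hA hB hδA hδB, tensorFunctional_tmul, ha, hx, one_mul,
        one_smul, LinearMap.flip_apply]
  -- Right half: `T₂` covers the first leg, so the slice is taken in the second leg, with the
  -- functionals that produce `δ_A` and `δ_B` there.
  obtain ⟨L, hL⟩ := exists_linear_limit (l := rightUnits A ×ˢ rightUnits B)
    (fun i => (twistedMul R T).flip (δA.right i.1 ⊗ₜ δB.right i.2)) fun q => by
      obtain ⟨w, hw⟩ := h₂ (a₀ ⊗ₜ b₀) q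
      refine ⟨sliceRight (tensorFunctional ωA ωB) w, ?_⟩
      filter_upwards [(isT2_iff hA hB).mp hw] with i hi
      rw [hi, sliceRight_coverLeft, hωA, hωB, LinearMap.flip_apply]
  refine ⟨EndPair.mk V L, fun q p => ?_, (isHash_iff hA hB).mpr ⟨hV, hL⟩⟩
  rw [EndPair.left_mk, EndPair.right_mk]
  obtain ⟨w, hw⟩ := h₂ (a₀ ⊗ₜ b₀) q
  -- `q (e δ u_y # f δ u_y')` is constant in large `e`, `f`, uniformly in `y`, `y'`
  have hconst : ∀ᶠ i in rightUnits A ×ˢ rightUnits B, ∀ y y',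
      sliceRight (tensorFunctional (ωA' y) (ωB' y')) w =
        twistedMul R T q ((δA.right i.1 * uA y) ⊗ₜ (δB.right i.2 * uB y')) := by
    filter_upwards [(isT2_iff hA hB).mp hw] with i hi y y'
    rw [hi, sliceRight_coverLeft, hωA', hωB']
  obtain ⟨i, hi, hi'⟩ := ((hL q).and hconst).exists
  have htA : Tendsto uA (rightUnits A) (leftUnits A) :=
    tendsto_iInf.mpr fun c => tendsto_principal.mpr (huA c)
  have htB : Tendsto uB (rightUnits B) (leftUnits B) :=
    tendsto_iInf.mpr fun c => tendsto_principal.mpr (huB c)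
  -- With `e`, `f` fixed, `y` and `y'` are taken so large that the local units disappear from `e δ_A
  -- u_y` and `f δ_B u_y'`, and `V p = (δ_A u_y # δ_B u_y') p`.
  obtain ⟨⟨y, y'⟩, hy₁, hy₂, hy₃⟩ := (((htA.prodMap htB).eventually (hV p)).and
    (((huA' (δA.right i.1)).prod_inl _).and ((huB' (δB.right i.2)).prod_inr _))).exists
  -- Now `y`, `y'` are fixed and a second pair `e`, `f` is chosen: large on the right to keep the
  -- slice unchanged, large on the left to disappear from `e δ_A u_y` and `f δ_B u_y'`.
  have hconst' : ∀ᶠ i in (leftUnits A ⊓ rightUnits A) ×ˢ (leftUnits B ⊓ rightUnits B), ∀ y y',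
      sliceRight (tensorFunctional (ωA' y) (ωB' y')) w =
        twistedMul R T q ((δA.right i.1 * uA y) ⊗ₜ (δB.right i.2 * uB y')) :=
    hconst.filter_mono (prod_mono inf_le_right inf_le_right)
  have hA' : ∀ᶠ e in leftUnits A ⊓ rightUnits A, e * δA.left (uA y) = δA.left (uA y) :=
    (eventually_leftUnits _).filter_mono inf_le_left
  have hB' : ∀ᶠ f in leftUnits B ⊓ rightUnits B, f * δB.left (uB y') = δB.left (uB y') :=
    (eventually_leftUnits _).filter_mono inf_le_left
  obtain ⟨j, hj₁, hj₂, hj₃⟩ :=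
    (hconst'.and ((hA'.prod_inl _).and (hB'.prod_inr _))).exists
  have hδ₁ : δA.right j.1 * uA y = δA.left (uA y) := (hδAmem j.1 (uA y)).trans hj₂
  have hδ₂ : δB.right j.2 * uB y' = δB.left (uB y') := (hδBmem j.2 (uB y')).trans hj₃
  have e₁ := (hi' y y').symm.trans (hj₁ y y')
  simp only at hy₂ hy₃
  -- Comparing the two choices of `e`, `f` gives `L q = q (δ_A u_y # δ_B u_y')`, so associativity
  -- yields `(L q) p = q (V p)`.
  rw [hy₂, hy₃, hδ₁, hδ₂] at e₁
  rw [hi, LinearMap.flip_apply, e₁, hRT.isAssociative, hy₁]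
  rfl

end Comul

/-! ### Construction of `Δ_{RT}`, its integral and its modular element -/

section Main

variable {k A B : Type*} [Field k]
  [NonUnitalRing A] [Module k A] [IsScalarTower k A A] [SMulCommClass k A A]
  [NonUnitalRing B] [Module k B] [IsScalarTower k B B] [SMulCommClass k B B]
  {HA : MultiplierHopf k A} {HB : MultiplierHopf k B}
  {R : B ⊗[k] A ≃ₗ[k] A ⊗[k] B} {T : A ⊗[k] B ≃ₗ[k] A ⊗[k] B}

/-- Elements `R(x ⊗ a)` span, so existence passes to sums. The last clause is not part of
`IsComulRT`; it comes from the product formula and is carried through the same induction. -/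
theorem exists_comulRT (hA : HasLocalUnits A) (hB : HasLocalUnits B) (regA : HA.IsRegular)
    (regB : HB.IsRegular) (hRT : IsTwistingPair R T)
    (hΔ : ∀ (x : B) (a : A), IsComulRT HA HB R T (R (x ⊗ₜ a))
      (oneHash R T (HB.comul x) * hashOne R T (HA.comul a))) :
    ∃ ΔRT : A ⊗[k] B →ₗ[k] multiplierAlgebra (tensorMul (twistedMul R T) (twistedMul R T)),
      (∀ z, IsComulRT HA HB R T z (ΔRT z)) ∧
      ∀ z p, ∃ w, tensorPair 1 (ofElem (twistedMul R T) p) * (ΔRT z : EndPair k _) =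
        ofElem (tensorMul (twistedMul R T) (twistedMul R T)) w := by
  have key : ∀ z, ∃ Υ : multiplierAlgebra (tensorMul (twistedMul R T) (twistedMul R T)),
      IsComulRT HA HB R T z Υ ∧ ∀ p, ∃ w, ∀ q, EndPair.right (Υ : EndPair k _) (q ⊗ₜ p) =
        (twistedMul R T q).rTensor (A ⊗[k] B) w := by
    intro z
    obtain ⟨t, rfl⟩ := R.surjective z
    induction t with
    | zero => exact ⟨0, by simpa using isComulRT_zero, fun p => ⟨0, by simp⟩⟩
    | tmul x a =>
      exact ⟨⟨_, mul_mem (hRT.oneHash_mem (HB.comul x).2) (hRT.hashOne_mem (HA.comul a).2)⟩,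
        hΔ x a, hRT.exists_right_eq hA hB regA regB x a⟩
    | add s t hs ht =>
      obtain ⟨Υ, hΥ, hΥ'⟩ := hs
      obtain ⟨Υ₁, hΥ₁, hΥ₁'⟩ := ht
      refine ⟨Υ + Υ₁, by rw [map_add]; exact hΥ.add hA hB hΥ₁, fun p => ?_⟩
      obtain ⟨w, hw⟩ := hΥ' p
      obtain ⟨w₁, hw₁⟩ := hΥ₁' p
      refine ⟨w + w₁, fun q => ?_⟩
      rw [map_add, ← hw, ← hw₁]
      rfl
  choose Δ h h' using key
  exact ⟨{
    toFun := Δ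
    map_add' := fun z z' => Subtype.ext ((h _).unique hA hB ((h z).add hA hB (h z')))
    map_smul' := fun c z => Subtype.ext ((h _).unique hA hB ((h z).smul hA hB c)) },
    h, fun z p => exists_one_mul_comul hA hB hRT (Δ z).2 (h' z p)⟩

variable {φA : A →ₗ[k] k} {φB : B →ₗ[k] k} {δA : EndPair k A} {δB : EndPair k B}

theorem IsHash.unique (hA : HasLocalUnits A) (hB : HasLocalUnits B)
    {m : EndPair k A} {n : EndPair k B} {v v' : EndPair k (A ⊗[k] B)} (h : IsHash R T m n v)
    (h' : IsHash R T m n v') : v = v' := by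
  have := hA.leftUnits_neBot
  have := hA.rightUnits_neBot
  have := hB.leftUnits_neBot
  have := hB.rightUnits_neBot
  rw [isHash_iff hA hB] at h h'
  refine EndPair.ext (LinearMap.ext fun p => ?_) (LinearMap.ext fun p => ?_)
  · obtain ⟨i, e, e'⟩ := ((h.1 p).and (h'.1 p)).exists
    rw [e, e']
  · obtain ⟨i, e, e'⟩ := ((h.2 p).and (h'.2 p)).exists
    rw [e, e']

theorem IsModularElement.unique {V : Type*} [AddCommGroup V] [Module k V]
    {μ : V →ₗ[k] V →ₗ[k] V} (hμ : IsNondegenerate (tensorMul μ μ))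
    {Δ : V → EndPair k (V ⊗[k] V)} {φ : V →ₗ[k] k} (hφ : φ ≠ 0) {δ δ' : EndPair k V}
    (h : IsModularElement μ Δ φ δ) (h' : IsModularElement μ Δ φ δ') : δ = δ' := by
  obtain ⟨z, hz⟩ := exists_apply_eq_one hφ
  refine EndPair.ext (LinearMap.ext fun b => ?_) (LinearMap.ext fun b => ?_)
  · obtain ⟨w, hw, e⟩ := (h z b).1
    obtain ⟨w', hw', e'⟩ := (h' z b).1
    rw [hμ.ofElem_injective (hw.symm.trans hw'), e', hz, one_smul, one_smul] at e
    exact e.symm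
  · obtain ⟨w, hw, e⟩ := (h z b).2
    obtain ⟨w', hw', e'⟩ := (h' z b).2
    rw [hμ.ofElem_injective (hw.symm.trans hw'), e', hz, one_smul, one_smul] at e
    exact e.symm

theorem isLeftIntegral_tensorFunctional (hA : HasLocalUnits A) (hB : HasLocalUnits B)
    (hRT : IsTwistingPair R T)
    {ΔRT : A ⊗[k] B → EndPair k ((A ⊗[k] B) ⊗[k] (A ⊗[k] B))}
    (hΔ : ∀ z, IsComulRT HA HB R T z (ΔRT z))
    (hmem : ∀ z, ΔRT z ∈ multiplierAlgebra (tensorMul (twistedMul R T) (twistedMul R T)))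
    (hφA : IsLeftIntegral (LinearMap.mul k A) (fun a => HA.comul a) φA)
    (hφB : IsLeftIntegral (LinearMap.mul k B) (fun b => HB.comul b) φB) :
    IsLeftIntegral (twistedMul R T) ΔRT (tensorFunctional φA φB) := by
  have := hA.rightUnits_neBot
  have := hB.rightUnits_neBot
  have hφ := tensorFunctional_ne_zero hφA.1 hφB.1
  -- Slicing `T₂(q ⊗ z)` with `φ(z) = 1` forces `q (e # f)` to be eventually constant, and the
  -- constant can only be `q`.
  have hunit : ∀ q, ∀ᶠ i in rightUnits A ×ˢ rightUnits B,
      q = twistedMul R T q (i.1 ⊗ₜ i.2) := by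
    intro q
    obtain ⟨z, hz⟩ := exists_apply_eq_one hφ
    obtain ⟨w, -, hw⟩ := (hΔ z).exists_mul_comul hA hB hRT (hmem z) q
    have h : ∀ᶠ i in rightUnits A ×ˢ rightUnits B,
        sliceRight (tensorFunctional φA φB) w = twistedMul R T q (i.1 ⊗ₜ i.2) := by
      filter_upwards [(isT2_iff hA hB).mp hw] with i hi
      rw [hi, sliceRight_coverLeft_integral hA hB hφA hφB, hz, one_smul]
    rwa [hRT.eq_of_eventually_mul hA hB h] at h
  refine ⟨hφ, fun z q => ?_⟩
  obtain ⟨w, hw', hw⟩ := (hΔ z).exists_mul_comul hA hB hRT (hmem z) q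
  obtain ⟨i, hi, hi'⟩ := (((isT2_iff hA hB).mp hw).and (hunit q)).exists
  refine ⟨w, hw', ?_⟩
  rw [hi, sliceRight_coverLeft_integral hA hB hφA hφB, ← hi']

/-- Slicing `T₁` gives the identity for `Δ(z)(1 ⊗ p)`. For `w = (1 ⊗ p) Δ(z)`, multiplying the slice
by `p'` on the right gives `φ(z) p (u p') = φ(z) (p u) p'`, and `p'` cancels. -/
theorem isModularElement_of_isHash (hA : HasLocalUnits A) (hB : HasLocalUnits B)
    (hRT : IsTwistingPair R T)
    {ΔRT : A ⊗[k] B → EndPair k ((A ⊗[k] B) ⊗[k] (A ⊗[k] B))}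
    (hΔ : ∀ z, IsComulRT HA HB R T z (ΔRT z))
    (hmem : ∀ z, ΔRT z ∈ multiplierAlgebra (tensorMul (twistedMul R T) (twistedMul R T)))
    (hcover : ∀ z p, ∃ w, tensorPair 1 (ofElem (twistedMul R T) p) * ΔRT z =
      ofElem (tensorMul (twistedMul R T) (twistedMul R T)) w)
    (hδA : IsModularElement (LinearMap.mul k A) (fun a => HA.comul a) φA δA)
    (hδB : IsModularElement (LinearMap.mul k B) (fun b => HB.comul b) φB δB)
    {u : EndPair k (A ⊗[k] B)} (humem : u ∈ multiplierAlgebra (twistedMul R T))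
    (hu : IsHash R T δA δB u) :
    IsModularElement (twistedMul R T) ΔRT (tensorFunctional φA φB) u := by
  have := hA.leftUnits_neBot
  have := hB.leftUnits_neBot
  have ha := hRT.isAssociative
  have hn := hRT.isNondegenerate_tensorMul hA hB
  have hleft : ∀ z p, ∃ w, ΔRT z * tensorPair 1 (ofElem (twistedMul R T) p) =
      ofElem (tensorMul (twistedMul R T) (twistedMul R T)) w ∧
      sliceLeft (tensorFunctional φA φB) w = tensorFunctional φA φB z • u.left p := by
    intro z p
    obtain ⟨w, hw', hw⟩ := (hΔ z).exists_comul_mul hA hB hRT (hmem z) p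
    obtain ⟨i, hi, hi'⟩ :=
      (((isT1_iff hA hB).mp hw).and (((isHash_iff hA hB).mp hu).1 p)).exists
    refine ⟨w, hw', ?_⟩
    rw [hi, sliceLeft_coverRight_modular hA hB hδA hδB, hi', LinearMap.flip_apply]
  refine fun z p => ⟨hleft z p, ?_⟩
  obtain ⟨w, hw⟩ := hcover z p
  refine ⟨w, hw, (hRT.isNondegenerate hA hB).eq_of_mul_right fun p' => ?_⟩
  obtain ⟨w', hw', e⟩ := hleft z p'
  have h : ((twistedMul R T).flip p').lTensor _ w = (twistedMul R T p).lTensor _ w' := by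
    refine hn.ofElem_injective ?_
    rw [← mul_tensorPair_one_ofElem ha ha hn, ← tensorPair_one_ofElem_mul ha ha hn, ← hw, ← hw',
      mul_assoc]
  rw [← LinearMap.flip_apply, ← sliceLeft_lTensor, h, sliceLeft_lTensor, e, map_smul, map_smul,
    LinearMap.smul_apply, humem]

end Main

end TwistedTensor

theorem proposition2p1p15 {k A B : Type*} [Field k]
    [NonUnitalRing A] [Module k A] [IsScalarTower k A A] [SMulCommClass k A A]
    [NonUnitalRing B] [Module k B] [IsScalarTower k B B] [SMulCommClass k B B]
    (hA : TwistedTensor.HasLocalUnits A) (hB : TwistedTensor.HasLocalUnits B)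
    (HA : TwistedTensor.MultiplierHopf k A) (HB : TwistedTensor.MultiplierHopf k B)
    (regA : HA.IsRegular) (regB : HB.IsRegular)
    (R : B ⊗[k] A ≃ₗ[k] A ⊗[k] B) (T : A ⊗[k] B ≃ₗ[k] A ⊗[k] B)
    (hRT : TwistedTensor.IsTwistingPair R T)
    (h₁ : ∀ z : A ⊗[k] B, (∀ p : A ⊗[k] B, TwistedTensor.TstarR R T (z ⊗ₜ p) = 0) → z = 0)
    (h₂ : ∀ z : A ⊗[k] B, (∀ p : A ⊗[k] B, TwistedTensor.RstarT R T (p ⊗ₜ z) = 0) → z = 0)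
    -- `Δ_{RT}(R(x ⊗ a)) = ((1 ⊗ 1) # Δ_B(x)) (Δ_A(a) # (1 ⊗ 1))`
    (hΔ : ∀ (x : B) (a : A), TwistedTensor.IsComulRT HA HB R T (R (x ⊗ₜ a))
      (TwistedTensor.oneHash R T (HB.comul x) * TwistedTensor.hashOne R T (HA.comul a)))
    (φA : A →ₗ[k] k) (φB : B →ₗ[k] k)
    (hφA : TwistedTensor.IsLeftIntegral (LinearMap.mul k A) (fun a => HA.comul a) φA)
    (hφB : TwistedTensor.IsLeftIntegral (LinearMap.mul k B) (fun b => HB.comul b) φB)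
    (δA : TwistedTensor.multiplierAlgebra (LinearMap.mul k A))
    (δB : TwistedTensor.multiplierAlgebra (LinearMap.mul k B))
    (hδA : TwistedTensor.IsModularElement (LinearMap.mul k A) (fun a => HA.comul a) φA δA)
    (hδB : TwistedTensor.IsModularElement (LinearMap.mul k B) (fun b => HB.comul b) φB δB) :
    -- the comultiplication `Δ_{RT} : A # B → M((A # B) ⊗ (A # B))`
    ∃ ΔRT : A ⊗[k] B →ₗ[k] TwistedTensor.multiplierAlgebra
        (TwistedTensor.tensorMul (TwistedTensor.twistedMul R T) (TwistedTensor.twistedMul R T)),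
      (∀ z Υ, TwistedTensor.IsComulRT HA HB R T z Υ ↔ Υ = ΔRT z) ∧
      -- the multiplier `u = δ_A # δ_B` of `A # B`
      ∃ u : TwistedTensor.multiplierAlgebra (TwistedTensor.twistedMul R T),
        (∀ v, TwistedTensor.IsHash R T δA δB v ↔ v = u) ∧
        -- is the modular element associated to the left integral `φ_A ⊗ φ_B`
        TwistedTensor.IsLeftIntegral (TwistedTensor.twistedMul R T) (fun z => ΔRT z)
          (TwistedTensor.tensorFunctional φA φB) ∧
        (∀ v, TwistedTensor.IsModularElement (TwistedTensor.twistedMul R T) (fun z => ΔRT z)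
          (TwistedTensor.tensorFunctional φA φB) v ↔ v = u) := by
  obtain ⟨ΔRT, hcomul, hcover⟩ :=
    TwistedTensor.exists_comulRT hA hB regA regB hRT hΔ
  obtain ⟨u, humem, hu⟩ := TwistedTensor.exists_isHash_modular hA hB regA regB hRT hφA hφB δA.2
    δB.2 hδA hδB (fun z p => ((hcomul z).1 p).imp fun w hw => hw.1)
    fun z q => ((hcomul z).2 q).imp fun w hw => hw.1
  have hint := TwistedTensor.isLeftIntegral_tensorFunctional hA hB hRT hcomul
    (fun z => (ΔRT z).2) hφA hφB
  have hmod := TwistedTensor.isModularElement_of_isHash hA hB hRT hcomul (fun z => (ΔRT z).2)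
    hcover hδA hδB humem hu
  -- All uniqueness claims range over arbitrary pairs of endomorphisms, so being a multiplier is a
  -- consequence of each characterization.
  refine ⟨ΔRT, fun z Υ => ⟨fun h => h.unique hA hB (hcomul z), fun h => h ▸ hcomul z⟩,
    ⟨u, humem⟩, fun v => ⟨fun h => h.unique hA hB hu, fun h => h ▸ hu⟩, hint,
    fun v => ⟨fun h => h.unique (hRT.isNondegenerate_tensorMul hA hB) hint.1 hmod,
      fun h => h ▸ hmod⟩⟩
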